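/- Let $k$ be a field, $A=A_1\times\cdots\times A_n$ a finite product of finite-dimensional division $k$-algebras with idempotents $e_1,\dots,e_n$, and $M$ a finite-dimensional $A$-bimodule on which $k$ acts centrally. Put $d_i=\dim_kA_i$ and $r_{ij}=\dim_k e_iMe_j$, and assume that the tensor algebra $\Lambda=T_A(M)$ is of Dynkin type, that is, that the matrix $\bigl(2\delta_{ij}-(r_{ij}+r_{ji})/d_i\bigr)_{i,j}$ is a Cartan matrix of Dynkin type (up to a simultaneous permutation of rows and columns, block diagonal with Cartan matrices of Dynkin diagrams $A_m,B_m,C_m,D_m,E_6,E_7,E_8,F_4,G_2$ as blocks). (Up to isomorphism, every basic finite-dimensional hereditary algebra of Dynkin type is of this form.) Write $D=\operatorname{Hom}_k(-,k)$ and fix a symmetrising element $\sigma\in DA$, i.e. $\sigma(ab)=\sigma(ba)$ for all $a,b$, and $\sigma(a-)=0$ implies $a=0$. Let $\rho=\sum_i m_i\otimes\mu_i\in M\otimes_ADM$ and $\ell=\sum_j\nu_j\otimes n_j\in DM\otimes_AM$ be representatives of the identities of $M_A$ and ${}_AM$: we have $\mu_i=\sigma f_i$ with $f_i\colon M\to A$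 right $A$-linear and $x=\sum_i m_if_i(x)$ for all $x\in M$, and $\nu_j=\sigma g_j$ with $g_j\colon M\to A$ left $A$-linear and $x=\sum_j g_j(x)n_j$ for all $x\in M$. Let \[ \Pi=T_A(M\oplus DM)/\langle\rho-\ell\rangle \] be the preprojective algebra of $\Lambda$. For a right $\Pi$-module $X$, the left hand map of the standard projective presentation \[ X\otimes_A\Pi\xrightarrow{\ \varepsilon_X\ }X\otimes_A(M\oplus DM)\otimes_A\Pi\to X\otimes_A\Pi\to X\to0 \] is the homomorphism of right $\Pi$-modules sending $x\otimes1$ to \[ \sum_i(xm_i\otimes\mu_i\otimes1+x\otimes m_i\otimes\mu_i)-\sum_j(x\nu_j\otimes n_j\otimes1+x\otimes\nu_j\otimes n_j), \] and the third syzygy of $X$ is the right $\Pi$-module $\operatorname{Ker}\varepsilon_X$, which is functorial in $X$. Then the third syzygy functor is naturally isomorphic to the inverse Nakayama functor, as functors from right $\Pi$-modules to right $\Pi$-modules: \[ \operatorname{Ker}\varepsilon_X\;\cong\;\nu^-X=\operatorname{Hom}_\Pi(D\Pi,X)\qquad\text{naturally in }X. \] -/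

import Mathlib

open scoped TensorProduct
open CategoryTheory MulOpposite

universe u

set_option linter.unusedSectionVars false

/-! ## Tensor products over a noncommutative ring

Right `A`-modules are modules over `Aᵐᵒᵖ`, so `op a • x` is the element `x a`. -/

section BalancedTensor

/-- The subgroup of `X ⊗[ℤ] Y` generated by the elements `x a ⊗ y - x ⊗ a y`. -/
def balancedRelations (A X Y : Type u) [Ring A] [AddCommGroup X] [Module Aᵐᵒᵖ X]
    [AddCommGroup Y] [Module A Y] : Submodule ℤ (X ⊗[ℤ] Y) :=
  Submodule.span ℤ {t | ∃ (x : X) (a : A) (y : Y), (op a • x) ⊗ₜ[ℤ] y - x ⊗ₜ[ℤ] (a • y) = t}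

/-- The tensor product `X ⊗_A Y` of a right `A`-module and a left `A`-module. -/
def BTensor (A X Y : Type u) [Ring A] [AddCommGroup X] [Module Aᵐᵒᵖ X]
    [AddCommGroup Y] [Module A Y] : Type u :=
  (X ⊗[ℤ] Y) ⧸ balancedRelations A X Y

namespace BTensor

section
variable (A : Type u) {X X' Y Z : Type u} [Ring A]
  [AddCommGroup X] [Module Aᵐᵒᵖ X] [AddCommGroup X'] [Module Aᵐᵒᵖ X']
  [AddCommGroup Y] [Module A Y] [AddCommGroup Z]

instance : AddCommGroup (BTensor A X Y) :=
  inferInstanceAs (AddCommGroup ((X ⊗[ℤ] Y) ⧸ balancedRelations A X Y))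

/-- The pure tensor `x ⊗ y`. -/
def tmul (x : X) (y : Y) : BTensor A X Y :=
  Submodule.Quotient.mk (p := balancedRelations A X Y) (x ⊗ₜ[ℤ] y)

theorem tmul_add (x : X) (y y' : Y) : tmul A x (y + y') = tmul A x y + tmul A x y' := by
  unfold tmul
  rw [TensorProduct.tmul_add]
  rfl

theorem add_tmul (x x' : X) (y : Y) : tmul A (x + x') y = tmul A x y + tmul A x' y := by
  unfold tmul
  rw [TensorProduct.add_tmul]
  rfl

theorem smul_tmul (x : X) (a : A) (y : Y) : tmul A (op a • x) y = tmul A x (a • y) :=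
  (Submodule.Quotient.eq _).2 (Submodule.subset_span ⟨x, a, y, rfl⟩)

/-- The additive map out of `X ⊗_A Y` induced by a balanced biadditive map. -/
def lift (b : X →+ Y →+ Z) (hb : ∀ (x : X) (a : A) (y : Y), b (op a • x) y = b x (a • y)) :
    BTensor A X Y →+ Z :=
  ((balancedRelations A X Y).liftQ
    (TensorProduct.liftAddHom b (fun r x y => by simp)).toIntLinearMap
    (Submodule.span_le.2 (by
      rintro _ ⟨x, a, y, rfl⟩
      simp [hb]))).toAddMonoidHom

theorem lift_tmul (b : X →+ Y →+ Z)
    (hb : ∀ (x : X) (a : A) (y : Y), b (op a • x) y = b x (a • y)) (x : X) (y : Y) :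
    lift A b hb (tmul A x y) = b x y := rfl

theorem induction_on {p : BTensor A X Y → Prop} (t : BTensor A X Y)
    (h0 : p 0) (h1 : ∀ x y, p (tmul A x y)) (h2 : ∀ s t, p s → p t → p (s + t)) : p t := by
  obtain ⟨t, rfl⟩ := Submodule.Quotient.mk_surjective _ t
  induction t using TensorProduct.induction_on with
  | zero => exact h0
  | tmul x y => exact h1 x y
  | add s t hs ht => exact h2 _ _ hs ht

theorem hom_ext {f g : BTensor A X Y →+ Z} (h : ∀ x y, f (tmul A x y) = g (tmul A x y)) :
    f = g := by
  ext t
  induction t using induction_on with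
  | h0 => simp
  | h1 x y => exact h x y
  | h2 s t hs ht => simp [hs, ht]

/-- Pure tensors as a biadditive map. -/
def tmulHom : X →+ Y →+ BTensor A X Y :=
  AddMonoidHom.mk' (fun x => AddMonoidHom.mk' (fun y => tmul A x y) (tmul_add A x))
    (fun x x' => by ext y; exact add_tmul A x x' y)

/-- If `S` acts on `Y` commuting with `A`, then it acts on `X ⊗_A Y` through the second factor. -/
def smulHom {S : Type u} [Ring S] [Module S Y] [SMulCommClass A S Y] (s : S) :
    BTensor A X Y →+ BTensor A X Y :=
  lift A (AddMonoidHom.mk' (fun x => (tmulHom A x).comp (DistribSMul.toAddMonoidHom Y s))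
      (fun x x' => by ext y; exact add_tmul A x x' (s • y)))
    (fun x a y => by
      change tmul A (op a • x) (s • y) = tmul A x (s • a • y)
      rw [smul_tmul, smul_comm])

instance {S : Type u} [Ring S] [Module S Y] [SMulCommClass A S Y] :
    Module S (BTensor A X Y) where
  smul s t := smulHom A s t
  one_smul t := by
    change smulHom A (1 : S) t = AddMonoidHom.id _ t
    congr 1
    refine hom_ext A fun x y => ?_
    change tmul A x ((1 : S) • y) = tmul A x y
    rw [one_smul]
  mul_smul s s' t := by
    change smulHom A (s * s') t = ((smulHom A s).comp (smulHom A s')) t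
    congr 1
    refine hom_ext A fun x y => ?_
    change tmul A x ((s * s') • y) = tmul A x (s • s' • y)
    rw [mul_smul]
  smul_zero s := map_zero (smulHom A s)
  smul_add s := map_add (smulHom A s)
  add_smul s s' t := by
    change smulHom A (s + s') t = (smulHom A s + smulHom A s' : BTensor A X Y →+ BTensor A X Y) t
    congr 1
    refine hom_ext A fun x y => ?_
    change tmul A x ((s + s') • y) = tmul A x (s • y) + tmul A x (s' • y)
    rw [add_smul, tmul_add]
  zero_smul t := by
    change smulHom A (0 : S) t = (0 : BTensor A X Y →+ BTensor A X Y) t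
    congr 1
    refine hom_ext A fun x y => ?_
    change tmul A x ((0 : S) • y) = 0
    rw [zero_smul]
    exact map_zero (tmulHom A x)

theorem smul_def {S : Type u} [Ring S] [Module S Y] [SMulCommClass A S Y]
    (s : S) (x : X) (y : Y) : s • tmul A x y = tmul A x (s • y) := rfl

/-- The map `f ⊗ 1`. -/
def mapLeftHom (f : X →ₗ[Aᵐᵒᵖ] X') : BTensor A X Y →+ BTensor A X' Y :=
  lift A (AddMonoidHom.mk' (fun x => (tmulHom A (f x) : Y →+ BTensor A X' Y))
      (fun x x' => by ext y; simp))
    (fun x a y => by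
      change tmul A (f (op a • x)) y = tmul A (f x) (a • y)
      rw [map_smul, smul_tmul])

/-- The map `f ⊗ 1`, as a linear map for an action of `S` on the second factor. -/
def mapLeft (S : Type u) [Ring S] [Module S Y] [SMulCommClass A S Y] (f : X →ₗ[Aᵐᵒᵖ] X') :
    BTensor A X Y →ₗ[S] BTensor A X' Y :=
  { mapLeftHom A f with
    map_smul' := fun s t => by
      change ((mapLeftHom A f).comp (smulHom A s)) t
        = ((smulHom A s : BTensor A X' Y →+ BTensor A X' Y).comp (mapLeftHom A f)) t
      congr 1
      exact hom_ext A fun x y => rfl }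

theorem mapLeft_tmul (S : Type u) [Ring S] [Module S Y] [SMulCommClass A S Y]
    (f : X →ₗ[Aᵐᵒᵖ] X') (x : X) (y : Y) : mapLeft A S f (tmul A x y) = tmul A (f x) y := rfl

end

end BTensor

end BalancedTensor

/-! ## The dual of a bimodule -/

section Dual

/-- The `k`-dual `DM = Hom_k(M, k)`. -/
def KDual (k M : Type u) [Field k] [AddCommGroup M] [Module k M] : Type u := M →ₗ[k] k

namespace KDual

variable {k M : Type u} [Field k] [AddCommGroup M] [Module k M]

instance : AddCommGroup (KDual k M) := inferInstanceAs (AddCommGroup (M →ₗ[k] k))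
instance : Module k (KDual k M) := inferInstanceAs (Module k (M →ₗ[k] k))
instance : FunLike (KDual k M) M k := inferInstanceAs (FunLike (M →ₗ[k] k) M k)

theorem ext {ξ η : KDual k M} (h : ∀ m, ξ m = η m) : ξ = η := LinearMap.ext h

theorem add_apply (ξ η : KDual k M) (m : M) : (ξ + η) m = ξ m + η m := rfl

/-- An element of the dual as a linear functional. -/
def toLinearMap (ξ : KDual k M) : M →ₗ[k] k := ξ

variable {A : Type u} [Ring A]

/-- `(a ξ)(m) = ξ(m a)`. -/
instance [Module Aᵐᵒᵖ M] [SMulCommClass Aᵐᵒᵖ k M] : Module A (KDual k M) where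
  smul a ξ := LinearMap.comp (toLinearMap ξ) (DistribSMul.toLinearMap k M (op a))
  one_smul ξ := ext fun m => congrArg ξ (one_smul Aᵐᵒᵖ m)
  mul_smul a b ξ := ext fun m => congrArg ξ (mul_smul (op b) (op a) m)
  smul_zero _ := rfl
  smul_add _ _ _ := rfl
  add_smul a b ξ := ext fun m =>
    (congrArg ξ (add_smul (op a) (op b) m)).trans (map_add (toLinearMap ξ) _ _)
  zero_smul ξ := ext fun m =>
    (congrArg ξ (zero_smul Aᵐᵒᵖ m)).trans (map_zero (toLinearMap ξ))

/-- `(ξ a)(m) = ξ(a m)`. -/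
instance [Module A M] [SMulCommClass A k M] : Module Aᵐᵒᵖ (KDual k M) where
  smul a ξ := LinearMap.comp (toLinearMap ξ) (DistribSMul.toLinearMap k M (unop a))
  one_smul ξ := ext fun m => congrArg ξ (one_smul A m)
  mul_smul a b ξ := ext fun m => congrArg ξ (mul_smul (unop b) (unop a) m)
  smul_zero _ := rfl
  smul_add _ _ _ := rfl
  add_smul a b ξ := ext fun m =>
    (congrArg ξ (add_smul (unop a) (unop b) m)).trans (map_add (toLinearMap ξ) _ _)
  zero_smul ξ := ext fun m =>
    (congrArg ξ (zero_smul A m)).trans (map_zero (toLinearMap ξ))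

theorem smul_apply [Module Aᵐᵒᵖ M] [SMulCommClass Aᵐᵒᵖ k M] (a : A) (ξ : KDual k M) (m : M) :
    (a • ξ) m = ξ (op a • m) := rfl

theorem op_smul_apply [Module A M] [SMulCommClass A k M] (a : A) (ξ : KDual k M) (m : M) :
    (op a • ξ) m = ξ (a • m) := rfl

instance [Module A M] [SMulCommClass A k M] [Module Aᵐᵒᵖ M] [SMulCommClass Aᵐᵒᵖ k M]
    [SMulCommClass A Aᵐᵒᵖ M] : SMulCommClass A Aᵐᵒᵖ (KDual k M) :=
  ⟨fun a b ξ => ext fun m => congrArg ξ (smul_comm (unop b) (op a) m)⟩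

end KDual

end Dual

/-! ## The tensor algebra of a bimodule -/

section BimoduleTensorAlgebra

variable (k A N : Type u) [Field k] [Ring A] [Algebra k A]
  [AddCommGroup N] [Module k N] [Module A N] [Module Aᵐᵒᵖ N]

/-- The relations which turn the tensor algebra of the vector space `A × N` into the tensor
algebra `T_A(N)`: the copy of `A` is a unital subring, and products of elements of `A` with
elements of `N` are given by the bimodule structure. -/
inductive BimodRel : TensorAlgebra k (A × N) → TensorAlgebra k (A × N) → Prop
  | one : BimodRel (TensorAlgebra.ι k ((1 : A), (0 : N))) 1
  | mul (a b : A) : BimodRel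
      (TensorAlgebra.ι k (a, (0 : N)) * TensorAlgebra.ι k (b, (0 : N)))
      (TensorAlgebra.ι k (a * b, (0 : N)))
  | left (a : A) (n : N) : BimodRel
      (TensorAlgebra.ι k (a, (0 : N)) * TensorAlgebra.ι k ((0 : A), n))
      (TensorAlgebra.ι k ((0 : A), a • n))
  | right (n : N) (a : A) : BimodRel
      (TensorAlgebra.ι k ((0 : A), n) * TensorAlgebra.ι k (a, (0 : N)))
      (TensorAlgebra.ι k ((0 : A), op a • n))

/-- The tensor algebra `T_A(N) = A ⊕ N ⊕ (N ⊗_A N) ⊕ ⋯` of the `A`-bimodule `N`, as the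
`k`-algebra generated by `A` and `N` subject to the relations above. -/
def BimodTensorAlgebra : Type u := RingQuot (BimodRel k A N)

namespace BimodTensorAlgebra

instance : Ring (BimodTensorAlgebra k A N) := inferInstanceAs (Ring (RingQuot (BimodRel k A N)))

instance : Algebra k (BimodTensorAlgebra k A N) :=
  inferInstanceAs (Algebra k (RingQuot (BimodRel k A N)))

/-- The map `A × N → T_A(N)`. -/
def gen : A × N →ₗ[k] BimodTensorAlgebra k A N :=
  (RingQuot.mkAlgHom k (BimodRel k A N)).toLinearMap.comp (TensorAlgebra.ι k)

/-- The inclusion of `A` in `T_A(N)`. -/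
def ofRing : A →ₐ[k] BimodTensorAlgebra k A N :=
  AlgHom.ofLinearMap ((gen k A N).comp (LinearMap.inl k A N))
    ((RingQuot.mkAlgHom_rel k BimodRel.one).trans (map_one _))
    (fun a b => ((map_mul (RingQuot.mkAlgHom k (BimodRel k A N)) _ _).symm.trans
      (RingQuot.mkAlgHom_rel k (BimodRel.mul a b))).symm)

/-- The inclusion of `N` in `T_A(N)`. -/
def ofBimod : N →ₗ[k] BimodTensorAlgebra k A N :=
  (gen k A N).comp (LinearMap.inr k A N)

theorem ofBimod_smul (a : A) (n : N) :
    ofBimod k A N (a • n) = ofRing k A N a * ofBimod k A N n :=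
  ((map_mul (RingQuot.mkAlgHom k (BimodRel k A N)) _ _).symm.trans
    (RingQuot.mkAlgHom_rel k (BimodRel.left a n))).symm

theorem ofBimod_op_smul (a : A) (n : N) :
    ofBimod k A N (op a • n) = ofBimod k A N n * ofRing k A N a :=
  ((map_mul (RingQuot.mkAlgHom k (BimodRel k A N)) _ _).symm.trans
    (RingQuot.mkAlgHom_rel k (BimodRel.right n a))).symm

end BimodTensorAlgebra

end BimoduleTensorAlgebra

/-! ## The preprojective algebra of a hereditary tensor algebra -/

/-- A symmetrising element `σ ∈ DA`. -/
structure SymmetrisingForm (k A : Type u) [Field k] [Ring A] [Algebra k A] where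
  toLinearMap : A →ₗ[k] k
  symm : ∀ a b : A, toLinearMap (a * b) = toLinearMap (b * a)
  nondegenerate : ∀ a : A, (∀ b : A, toLinearMap (a * b) = 0) → a = 0

/-- Representatives `∑ m i ⊗ f i` of the identity in `End(M_A) = M ⊗_A Hom_A(M_A, A)` and
`∑ g j ⊗ n j` of the identity in `End(_A M) = Hom_A(_A M, A) ⊗_A M`. -/
structure IdentityRepresentatives (A M : Type u) [Ring A] [AddCommGroup M] [Module A M]
    [Module Aᵐᵒᵖ M] where
  r : ℕ
  m : Fin r → M
  f : Fin r → (M →ₗ[Aᵐᵒᵖ] A)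
  sum_right : ∀ x : M, ∑ i, op (f i x) • m i = x
  s : ℕ
  n : Fin s → M
  g : Fin s → (M →ₗ[A] A)
  sum_left : ∀ x : M, ∑ j, g j x • n j = x

section Preprojective

variable {k A M : Type u} [Field k] [Ring A] [Algebra k A]
  [AddCommGroup M] [Module k M] [Module A M] [Module Aᵐᵒᵖ M] [SMulCommClass A Aᵐᵒᵖ M]
  [IsScalarTower k A M] [IsScalarTower k Aᵐᵒᵖ M]

namespace IdentityRepresentatives

/-- The element `μ i = σ ∘ f i` of `DM`. -/
def mu (d : IdentityRepresentatives A M) (σ : SymmetrisingForm k A) (i : Fin d.r) : KDual k M :=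
  σ.toLinearMap.comp ((d.f i).restrictScalars k)

/-- The element `ν j = σ ∘ g j` of `DM`. -/
def nu (d : IdentityRepresentatives A M) (σ : SymmetrisingForm k A) (j : Fin d.s) : KDual k M :=
  σ.toLinearMap.comp ((d.g j).restrictScalars k)

theorem mu_apply (d : IdentityRepresentatives A M) (σ : SymmetrisingForm k A) (i : Fin d.r)
    (x : M) : d.mu σ i x = σ.toLinearMap (d.f i x) := rfl

theorem nu_apply (d : IdentityRepresentatives A M) (σ : SymmetrisingForm k A) (j : Fin d.s)
    (x : M) : d.nu σ j x = σ.toLinearMap (d.g j x) := rfl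

/-- `a ρ = ρ a`, for any balanced biadditive map in place of the tensor product. -/
theorem rho_comm (d : IdentityRepresentatives A M) (σ : SymmetrisingForm k A) {Z : Type u}
    [AddCommGroup Z] (F : M →+ KDual k M →+ Z)
    (hF : ∀ (m : M) (a : A) (ξ : KDual k M), F (op a • m) ξ = F m (a • ξ)) (a : A) :
    ∑ i, F (a • d.m i) (d.mu σ i) = ∑ i, F (d.m i) (op a • d.mu σ i) := by
  have h1 : ∀ i, F (a • d.m i) (d.mu σ i)
      = ∑ l, F (d.m l) (d.f l (a • d.m i) • d.mu σ i) := by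
    intro i
    conv_lhs => rw [← d.sum_right (a • d.m i)]
    simp only [map_sum, AddMonoidHom.finsetSum_apply, hF]
  have h2 : ∀ l, ∑ i, d.f l (a • d.m i) • d.mu σ i = op a • d.mu σ l := by
    intro l
    refine KDual.ext fun x => ?_
    have e1 : (∑ i, d.f l (a • d.m i) • d.mu σ i) x
        = ∑ i, (d.f l (a • d.m i) • d.mu σ i) x := by
      exact LinearMap.sum_apply _ _ _
    rw [e1, KDual.op_smul_apply, mu_apply]
    conv_rhs => rw [← d.sum_right x]
    simp only [KDual.smul_apply, mu_apply, map_smul, Finset.smul_sum, map_sum, smul_comm a]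
    refine Finset.sum_congr rfl fun i _ => ?_
    simp only [smul_eq_mul_unop, unop_op]
    exact σ.symm _ _
  simp only [h1]
  rw [Finset.sum_comm]
  simp only [← map_sum, h2]

/-- `a ℓ = ℓ a`, for any balanced biadditive map in place of the tensor product. -/
theorem ell_comm (d : IdentityRepresentatives A M) (σ : SymmetrisingForm k A) {Z : Type u}
    [AddCommGroup Z] (F : KDual k M →+ M →+ Z)
    (hF : ∀ (ξ : KDual k M) (a : A) (m : M), F (op a • ξ) m = F ξ (a • m)) (a : A) :
    ∑ j, F (a • d.nu σ j) (d.n j) = ∑ j, F (d.nu σ j) (op a • d.n j) := by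
  have h1 : ∀ j, F (d.nu σ j) (op a • d.n j)
      = ∑ l, F (op (d.g l (op a • d.n j)) • d.nu σ j) (d.n l) := by
    intro j
    conv_lhs => rw [← d.sum_left (op a • d.n j)]
    simp only [map_sum, hF]
  have h2 : ∀ l, ∑ j, op (d.g l (op a • d.n j)) • d.nu σ j = a • d.nu σ l := by
    intro l
    refine KDual.ext fun x => ?_
    have e1 : (∑ j, op (d.g l (op a • d.n j)) • d.nu σ j) x
        = ∑ j, (op (d.g l (op a • d.n j)) • d.nu σ j) x := by
      exact LinearMap.sum_apply _ _ _
    rw [e1, KDual.smul_apply, nu_apply]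
    conv_rhs => rw [← d.sum_left x]
    simp only [KDual.op_smul_apply, nu_apply, map_smul, Finset.smul_sum, map_sum,
      ← smul_comm _ (op a)]
    refine Finset.sum_congr rfl fun i _ => ?_
    simp only [smul_eq_mul]
    exact σ.symm _ _
  simp only [h1]
  rw [Finset.sum_comm]
  simp only [← AddMonoidHom.finsetSum_apply, ← map_sum, h2]

end IdentityRepresentatives

variable (σ : SymmetrisingForm k A) (d : IdentityRepresentatives A M)

/-- The element `c = ρ - ℓ = ∑ m i μ i - ∑ ν j n j` of `T_A(M ⊕ DM)`. -/
def preprojectiveElement : BimodTensorAlgebra k A (M × KDual k M) :=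
  ∑ i, BimodTensorAlgebra.ofBimod k A (M × KDual k M) (d.m i, 0) *
      BimodTensorAlgebra.ofBimod k A (M × KDual k M) (0, d.mu σ i)
    - ∑ j, BimodTensorAlgebra.ofBimod k A (M × KDual k M) (0, d.nu σ j) *
      BimodTensorAlgebra.ofBimod k A (M × KDual k M) (d.n j, 0)

/-- The preprojective algebra `Π = T_A(M ⊕ DM) / ⟨c⟩` of `T_A(M)`. -/
def Preprojective : Type u :=
  RingQuot (fun s t : BimodTensorAlgebra k A (M × KDual k M) =>
    s = preprojectiveElement σ d ∧ t = 0)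

namespace Preprojective

instance : Ring (Preprojective σ d) :=
  inferInstanceAs (Ring (RingQuot (fun s t : BimodTensorAlgebra k A (M × KDual k M) =>
    s = preprojectiveElement σ d ∧ t = 0)))

instance : Algebra k (Preprojective σ d) :=
  inferInstanceAs (Algebra k (RingQuot (fun s t : BimodTensorAlgebra k A (M × KDual k M) =>
    s = preprojectiveElement σ d ∧ t = 0)))

/-- The projection `T_A(M ⊕ DM) → Π`. -/
def proj : BimodTensorAlgebra k A (M × KDual k M) →ₐ[k] Preprojective σ d :=
  RingQuot.mkAlgHom k _

/-- The algebra map `A → Π`. -/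
def ofRing : A →ₐ[k] Preprojective σ d :=
  (proj σ d).comp (BimodTensorAlgebra.ofRing k A (M × KDual k M))

/-- The map `M ⊕ DM → Π`. -/
def ofBimod : M × KDual k M →ₗ[k] Preprojective σ d :=
  (proj σ d).toLinearMap.comp (BimodTensorAlgebra.ofBimod k A (M × KDual k M))

theorem ofBimod_smul (a : A) (n : M × KDual k M) :
    ofBimod σ d (a • n) = ofRing σ d a * ofBimod σ d n := by
  change proj σ d _ = proj σ d _ * proj σ d _
  rw [BimodTensorAlgebra.ofBimod_smul, map_mul]
  rfl

theorem ofBimod_op_smul (a : A) (n : M × KDual k M) :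
    ofBimod σ d (op a • n) = ofBimod σ d n * ofRing σ d a := by
  change proj σ d _ = proj σ d _ * proj σ d _
  rw [BimodTensorAlgebra.ofBimod_op_smul, map_mul]
  rfl

/-- `Π` as a left `A`-module. -/
instance : Module A (Preprojective σ d) :=
  Module.compHom (Preprojective σ d) (ofRing σ d).toRingHom

theorem smul_eq (a : A) (p : Preprojective σ d) : a • p = ofRing σ d a * p := rfl

instance : SMulCommClass A (Preprojective σ d)ᵐᵒᵖ (Preprojective σ d) :=
  ⟨fun a q p => (mul_assoc (ofRing σ d a) p (unop q)).symm⟩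

/-- A right `Π`-module, regarded as a right `A`-module. -/
def Res (_σ : SymmetrisingForm k A) (_d : IdentityRepresentatives A M) (X : Type u) : Type u := X

section
variable (X : Type u) [AddCommGroup X] [Module (Preprojective σ d)ᵐᵒᵖ X]

instance : AddCommGroup (Res σ d X) := inferInstanceAs (AddCommGroup X)

instance : Module (Preprojective σ d)ᵐᵒᵖ (Res σ d X) :=
  inferInstanceAs (Module (Preprojective σ d)ᵐᵒᵖ X)

instance : Module Aᵐᵒᵖ (Res σ d X) :=
  Module.compHom X (ofRing σ d).toRingHom.op

theorem op_smul_eq (a : A) (x : Res σ d X) : op a • x = op (ofRing σ d a) • x := rfl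

/-! ### The standard presentation and the third syzygy -/

/-- `X ⊗_A Π`, the outer terms of the standard projective presentation of `X`. -/
abbrev StdOuter : Type u := BTensor A (Res σ d X) (Preprojective σ d)

/-- `X ⊗_A (M ⊕ DM) ⊗_A Π`, the middle term of the standard projective presentation of `X`. -/
abbrev StdMiddle : Type u :=
  BTensor A (BTensor A (Res σ d X) (M × KDual k M)) (Preprojective σ d)

variable {X}

/-- The pure tensor `x ⊗ n ⊗ p`. -/
def tmul₃ (x : Res σ d X) (n : M × KDual k M) (p : Preprojective σ d) : StdMiddle σ d X :=
  BTensor.tmul A (BTensor.tmul A x n) p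

/-- The right action `x n` of `n ∈ M ⊕ DM` on `x ∈ X`. -/
def act (x : Res σ d X) (n : M × KDual k M) : Res σ d X := op (ofBimod σ d n) • x

/-- The element `x n ⊗ n' ⊗ p + x ⊗ n ⊗ n' p`. -/
def leftTerm (x : Res σ d X) (p : Preprojective σ d) (n n' : M × KDual k M) :
    StdMiddle σ d X :=
  tmul₃ σ d (act σ d x n) n' p + tmul₃ σ d x n (ofBimod σ d n' * p)

/-- The element
`∑ (x mᵢ ⊗ μᵢ ⊗ p + x ⊗ mᵢ ⊗ μᵢ p) - ∑ (x νⱼ ⊗ nⱼ ⊗ p + x ⊗ νⱼ ⊗ nⱼ p)`. -/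
def leftMapAux (x : Res σ d X) (p : Preprojective σ d) : StdMiddle σ d X :=
  ∑ i, leftTerm σ d x p (d.m i, 0) (0, d.mu σ i)
    - ∑ j, leftTerm σ d x p (0, d.nu σ j) (d.n j, 0)

theorem tmul₃_add_left (x x' : Res σ d X) (n : M × KDual k M) (p : Preprojective σ d) :
    tmul₃ σ d (x + x') n p = tmul₃ σ d x n p + tmul₃ σ d x' n p := by
  simp only [tmul₃, BTensor.add_tmul]

theorem tmul₃_add_mid (x : Res σ d X) (n n' : M × KDual k M) (p : Preprojective σ d) :
    tmul₃ σ d x (n + n') p = tmul₃ σ d x n p + tmul₃ σ d x n' p := by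
  simp only [tmul₃, BTensor.tmul_add, BTensor.add_tmul]

theorem tmul₃_add_right (x : Res σ d X) (n : M × KDual k M) (p p' : Preprojective σ d) :
    tmul₃ σ d x n (p + p') = tmul₃ σ d x n p + tmul₃ σ d x n p' := by
  simp only [tmul₃, BTensor.tmul_add]

theorem tmul₃_smul_left (x : Res σ d X) (a : A) (n : M × KDual k M) (p : Preprojective σ d) :
    tmul₃ σ d (op a • x) n p = tmul₃ σ d x (a • n) p := by
  simp only [tmul₃, BTensor.smul_tmul]

theorem tmul₃_smul_right (x : Res σ d X) (n : M × KDual k M) (a : A) (p : Preprojective σ d) :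
    tmul₃ σ d x (op a • n) p = tmul₃ σ d x n (a • p) := by
  simp only [tmul₃, ← BTensor.smul_tmul, BTensor.smul_def]

theorem act_add_left (x x' : Res σ d X) (n : M × KDual k M) :
    act σ d (x + x') n = act σ d x n + act σ d x' n := smul_add _ _ _

theorem act_add_right (x : Res σ d X) (n n' : M × KDual k M) :
    act σ d x (n + n') = act σ d x n + act σ d x n' := by
  unfold act
  rw [map_add]
  exact add_smul (op (ofBimod σ d n)) (op (ofBimod σ d n')) x

theorem act_smul_left (x : Res σ d X) (a : A) (n : M × KDual k M) :
    act σ d (op a • x) n = act σ d x (a • n) := by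
  simp only [act, ofBimod_smul, op_smul_eq, op_mul, mul_smul]

theorem act_smul_right (x : Res σ d X) (n : M × KDual k M) (a : A) :
    act σ d x (op a • n) = op a • act σ d x n := by
  simp only [act, ofBimod_op_smul, op_smul_eq, op_mul, mul_smul]

/-- `leftTerm` as a biadditive map in `n` and `n'`. -/
def leftTermHom (x : Res σ d X) (p : Preprojective σ d) :
    (M × KDual k M) →+ (M × KDual k M) →+ StdMiddle σ d X :=
  AddMonoidHom.mk' (fun n => AddMonoidHom.mk' (fun n' => leftTerm σ d x p n n')
      (fun n' n'' => by
        simp only [leftTerm, map_add, add_mul, tmul₃_add_mid, tmul₃_add_right]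
        abel))
    (fun n n'' => by
      refine AddMonoidHom.ext fun n' => ?_
      change leftTerm σ d x p (n + n'') n' = leftTerm σ d x p n n' + leftTerm σ d x p n'' n'
      simp only [leftTerm, act_add_right, tmul₃_add_mid, tmul₃_add_left]
      abel)

theorem leftTerm_balanced (x : Res σ d X) (p : Preprojective σ d) (n : M × KDual k M) (a : A)
    (n' : M × KDual k M) :
    leftTerm σ d x p (op a • n) n' = leftTerm σ d x p n (a • n') := by
  simp only [leftTerm, act_smul_right, tmul₃_smul_left, tmul₃_smul_right, ofBimod_smul, smul_eq,
    mul_assoc]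

theorem leftTerm_smul_left (x : Res σ d X) (a : A) (p : Preprojective σ d)
    (n n' : M × KDual k M) :
    leftTerm σ d (op a • x) p n n' = leftTerm σ d x p (a • n) n' := by
  simp only [leftTerm, act_smul_left, tmul₃_smul_left]

theorem leftTerm_smul_right (x : Res σ d X) (a : A) (p : Preprojective σ d)
    (n n' : M × KDual k M) :
    leftTerm σ d x (a • p) n n' = leftTerm σ d x p n (op a • n') := by
  simp only [leftTerm, tmul₃_smul_right, ofBimod_op_smul, smul_eq, mul_assoc]

theorem leftMapAux_balanced (x : Res σ d X) (a : A) (p : Preprojective σ d) :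
    leftMapAux σ d (op a • x) p = leftMapAux σ d x (a • p) := by
  have h1 := d.rho_comm σ (((leftTermHom σ d x p).comp
    (AddMonoidHom.inl M (KDual k M))).compr₂ (AddMonoidHom.id _) |>.compl₂
      (AddMonoidHom.inr M (KDual k M)))
    (fun m b ξ => by
      change leftTerm σ d x p (op b • m, 0) (0, ξ) = leftTerm σ d x p (m, 0) (0, b • ξ)
      simpa using leftTerm_balanced σ d x p (m, 0) b (0, ξ)) a
  have h2 := d.ell_comm σ (((leftTermHom σ d x p).comp
    (AddMonoidHom.inr M (KDual k M))).compr₂ (AddMonoidHom.id _) |>.compl₂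
      (AddMonoidHom.inl M (KDual k M)))
    (fun ξ b m => by
      change leftTerm σ d x p (0, op b • ξ) (m, 0) = leftTerm σ d x p (0, ξ) (b • m, 0)
      simpa using leftTerm_balanced σ d x p (0, ξ) b (m, 0)) a
  change ∑ i, leftTerm σ d x p (a • d.m i, 0) (0, d.mu σ i)
    = ∑ i, leftTerm σ d x p (d.m i, 0) (0, op a • d.mu σ i) at h1
  change ∑ j, leftTerm σ d x p (0, a • d.nu σ j) (d.n j, 0)
    = ∑ j, leftTerm σ d x p (0, d.nu σ j) (op a • d.n j, 0) at h2
  simp only [leftMapAux, leftTerm_smul_left, leftTerm_smul_right, Prod.smul_mk, smul_zero, h1, h2]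

/-- The additive map underlying `leftMap`. -/
def leftMapHom : StdOuter σ d X →+ StdMiddle σ d X :=
  BTensor.lift A (AddMonoidHom.mk' (fun x => AddMonoidHom.mk' (fun p => leftMapAux σ d x p)
      (fun p p' => by
        simp only [leftMapAux, leftTerm, mul_add, tmul₃_add_right, Finset.sum_add_distrib]
        abel))
    (fun x x' => by
      refine AddMonoidHom.ext fun p => ?_
      change leftMapAux σ d (x + x') p = leftMapAux σ d x p + leftMapAux σ d x' p
      simp only [leftMapAux, leftTerm, act_add_left, tmul₃_add_left, Finset.sum_add_distrib]
      abel))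
    (leftMapAux_balanced σ d)

theorem smul_leftMapAux (q : (Preprojective σ d)ᵐᵒᵖ) (x : Res σ d X) (p : Preprojective σ d) :
    q • leftMapAux σ d x p = leftMapAux σ d x (q • p) := by
  have h : ∀ n n', q • leftTerm σ d x p n n' = leftTerm σ d x (q • p) n n' := by
    intro n n'
    simp only [leftTerm, smul_add, tmul₃, BTensor.smul_def, mul_smul_comm]
  simp only [leftMapAux, smul_sub, Finset.smul_sum, h]

variable (X) in
/-- The left hand map `X ⊗_A Π → X ⊗_A (M ⊕ DM) ⊗_A Π` of the standard projective presentation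
of the right `Π`-module `X`. It is the homomorphism of right `Π`-modules which sends `x ⊗ 1` to
`∑ (x mᵢ ⊗ μᵢ ⊗ 1 + x ⊗ mᵢ ⊗ μᵢ) - ∑ (x νⱼ ⊗ nⱼ ⊗ 1 + x ⊗ νⱼ ⊗ nⱼ)`. -/
def leftMap : StdOuter σ d X →ₗ[(Preprojective σ d)ᵐᵒᵖ] StdMiddle σ d X :=
  { leftMapHom σ d with
    map_smul' := fun q t => by
      change ((leftMapHom σ d).comp (BTensor.smulHom A q)) t
        = ((BTensor.smulHom A q).comp (leftMapHom σ d)) t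
      congr 1
      exact BTensor.hom_ext A fun x p => (smul_leftMapAux σ d q x p).symm }

theorem leftMap_tmul (x : Res σ d X) (p : Preprojective σ d) :
    leftMap σ d X (BTensor.tmul A x p) = leftMapAux σ d x p := rfl

variable {X' : Type u} [AddCommGroup X'] [Module (Preprojective σ d)ᵐᵒᵖ X']

/-- A homomorphism of right `Π`-modules, regarded as a homomorphism of right `A`-modules. -/
def resMap (f : X →ₗ[(Preprojective σ d)ᵐᵒᵖ] X') : Res σ d X →ₗ[Aᵐᵒᵖ] Res σ d X' where
  toFun := f
  map_add' := map_add f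
  map_smul' a x := map_smul f (op (ofRing σ d (unop a))) x

/-- The map `f ⊗ 1` on the left hand terms of the standard presentations. -/
def outerMap (f : X →ₗ[(Preprojective σ d)ᵐᵒᵖ] X') :
    StdOuter σ d X →ₗ[(Preprojective σ d)ᵐᵒᵖ] StdOuter σ d X' :=
  BTensor.mapLeft A _ (resMap σ d f)

/-- The map `f ⊗ 1 ⊗ 1` on the middle terms of the standard presentations. -/
def middleMap (f : X →ₗ[(Preprojective σ d)ᵐᵒᵖ] X') :
    StdMiddle σ d X →ₗ[(Preprojective σ d)ᵐᵒᵖ] StdMiddle σ d X' :=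
  BTensor.mapLeft A _ (BTensor.mapLeft A Aᵐᵒᵖ (resMap σ d f))

theorem leftMap_natural (f : X →ₗ[(Preprojective σ d)ᵐᵒᵖ] X') (t : StdOuter σ d X) :
    leftMap σ d X' (outerMap σ d f t) = middleMap σ d f (leftMap σ d X t) := by
  have h : ∀ x p n n', middleMap σ d f (leftTerm σ d x p n n')
      = leftTerm σ d (resMap σ d f x) p n n' := by
    intro x p n n'
    have e : resMap σ d f (act σ d x n) = act σ d (resMap σ d f x) n :=
      map_smul f (op (ofBimod σ d n)) x
    simp only [leftTerm, map_add, tmul₃, middleMap, BTensor.mapLeft_tmul, e]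
  induction t using BTensor.induction_on with
  | h0 => simp
  | h1 x p =>
    simp only [outerMap, BTensor.mapLeft_tmul, leftMap_tmul, leftMapAux, map_sub, map_sum, h]
  | h2 s t hs ht => simp only [map_add, hs, ht]

variable (X) in
/-- The third syzygy of `X`: the kernel of the left hand map of its standard projective
presentation. -/
def ThirdSyzygy : Submodule (Preprojective σ d)ᵐᵒᵖ (StdOuter σ d X) :=
  LinearMap.ker (leftMap σ d X)

/-- The map induced by `f ⊗ 1` on third syzygies. -/
def thirdSyzygyMap (f : X →ₗ[(Preprojective σ d)ᵐᵒᵖ] X') :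
    ThirdSyzygy σ d X →ₗ[(Preprojective σ d)ᵐᵒᵖ] ThirdSyzygy σ d X' :=
  (outerMap σ d f).restrict fun t ht => by
    change leftMap σ d X' (outerMap σ d f t) = 0
    rw [leftMap_natural, show leftMap σ d X t = 0 from ht, map_zero]

end

/-- The third syzygy functor on right `Π`-modules. -/
def thirdSyzygyFunctor :
    ModuleCat.{u} (Preprojective σ d)ᵐᵒᵖ ⥤ ModuleCat.{u} (Preprojective σ d)ᵐᵒᵖ where
  obj X := ModuleCat.of _ (ThirdSyzygy σ d X)
  map f := ModuleCat.ofHom (thirdSyzygyMap σ d f.hom)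
  map_id X := by
    refine ModuleCat.hom_ext (LinearMap.ext fun (t : ThirdSyzygy σ d X) => ?_)
    have h : (outerMap σ d (LinearMap.id : X →ₗ[(Preprojective σ d)ᵐᵒᵖ] X)).toAddMonoidHom
        = AddMonoidHom.id (StdOuter σ d X) := BTensor.hom_ext A fun x p => rfl
    exact Subtype.ext (DFunLike.congr_fun h t.1)
  map_comp {X Y Z} f g := by
    refine ModuleCat.hom_ext (LinearMap.ext fun (t : ThirdSyzygy σ d X) => ?_)
    have h : (outerMap σ d (g.hom ∘ₗ f.hom)).toAddMonoidHom
        = (outerMap σ d g.hom).toAddMonoidHom.comp (outerMap σ d f.hom).toAddMonoidHom :=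
      BTensor.hom_ext A fun x p => rfl
    exact Subtype.ext (DFunLike.congr_fun h t.1)

end Preprojective

end Preprojective

/-! ## The inverse Nakayama functor -/

section Nakayama

variable (k R : Type u) [Field k] [Ring R] [Algebra k R]

/-- The right `R`-module `Hom_R(DR, X)` of homomorphisms of right `R`-modules. -/
def NakayamaHom (X : Type u) [AddCommGroup X] [Module Rᵐᵒᵖ X] : Type u :=
  KDual k R →ₗ[Rᵐᵒᵖ] X

namespace NakayamaHom

variable {k R} {X : Type u} [AddCommGroup X] [Module Rᵐᵒᵖ X]

instance : AddCommGroup (NakayamaHom k R X) :=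
  inferInstanceAs (AddCommGroup (KDual k R →ₗ[Rᵐᵒᵖ] X))

instance : FunLike (NakayamaHom k R X) (KDual k R) X :=
  inferInstanceAs (FunLike (KDual k R →ₗ[Rᵐᵒᵖ] X) (KDual k R) X)

theorem ext {f g : NakayamaHom k R X} (h : ∀ θ, f θ = g θ) : f = g := LinearMap.ext h

/-- An element of `Hom_R(DR, X)` as a linear map. -/
def toLinearMap (f : NakayamaHom k R X) : KDual k R →ₗ[Rᵐᵒᵖ] X := f

/-- `(f r)(θ) = f(r θ)`. -/
instance : Module Rᵐᵒᵖ (NakayamaHom k R X) where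
  smul r f :=
    { toFun := fun θ => f (unop r • θ)
      map_add' := fun θ η => by
        rw [smul_add]
        exact map_add (toLinearMap f) _ _
      map_smul' := fun s θ => by
        rw [smul_comm]
        exact map_smul (toLinearMap f) _ _ }
  one_smul f := ext fun θ => congrArg f (one_smul R θ)
  mul_smul r s f := ext fun θ => congrArg f (mul_smul (unop s) (unop r) θ)
  smul_zero _ := rfl
  smul_add _ _ _ := rfl
  add_smul r s f := ext fun θ =>
    (congrArg f (add_smul (unop r) (unop s) θ)).trans (map_add (toLinearMap f) _ _)
  zero_smul f := ext fun θ =>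
    (congrArg f (zero_smul R θ)).trans (map_zero (toLinearMap f))

theorem op_smul_apply (r : R) (f : NakayamaHom k R X) (θ : KDual k R) :
    (op r • f) θ = f (r • θ) := rfl

end NakayamaHom

/-- The inverse Nakayama functor `ν⁻ = Hom_R(DR, -)` on right `R`-modules. -/
def inverseNakayamaFunctor : ModuleCat.{u} Rᵐᵒᵖ ⥤ ModuleCat.{u} Rᵐᵒᵖ where
  obj X := ModuleCat.of _ (NakayamaHom k R X)
  map f := ModuleCat.ofHom
    { toFun := fun g => f.hom.comp g.toLinearMap
      map_add' := fun _ _ => LinearMap.comp_add _ _ _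
      map_smul' := fun _ _ => rfl }
  map_id _ := rfl
  map_comp _ _ := rfl

end Nakayama

/-! ## Dynkin type -/

/-- The connected Dynkin diagrams (in low rank some are empty, repeated or decomposable). -/
inductive DynkinDiagram
  | A (n : ℕ) | B (n : ℕ) | C (n : ℕ) | D (n : ℕ) | E₆ | E₇ | E₈ | F₄ | G₂

namespace DynkinDiagram

/-- The number of vertices. -/
def rank : DynkinDiagram → ℕ
  | A n => n
  | B n => n
  | C n => n
  | D n => n
  | E₆ => 6
  | E₇ => 7
  | E₈ => 8
  | F₄ => 4
  | G₂ => 2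

/-- The Cartan matrix. -/
def cartan : (t : DynkinDiagram) → Matrix (Fin t.rank) (Fin t.rank) ℤ
  | A n => CartanMatrix.A n
  | B n => CartanMatrix.B n
  | C n => CartanMatrix.C n
  | D n => CartanMatrix.D n
  | E₆ => CartanMatrix.E₆
  | E₇ => CartanMatrix.E₇
  | E₈ => CartanMatrix.E₈
  | F₄ => CartanMatrix.F₄
  | G₂ => CartanMatrix.G₂

end DynkinDiagram

/-- `C` is a Cartan matrix of Dynkin type: up to a bijection of the index sets, it is block
diagonal with Cartan matrices of Dynkin diagrams as blocks. -/
def IsDynkinCartan {ι : Type} (C : Matrix ι ι ℚ) : Prop :=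
  ∃ (m : ℕ) (t : Fin m → DynkinDiagram) (e : ι ≃ (s : Fin m) × Fin (t s).rank),
    C = ((Matrix.blockDiagonal' fun s => (t s).cartan).map (Int.cast : ℤ → ℚ)).submatrix e e

section Dynkin

variable (k : Type u) [Field k] {ι : Type} [DecidableEq ι] (D : ι → Type u)
  [∀ i, DivisionRing (D i)] [∀ i, Algebra k (D i)]
  (M : Type u) [AddCommGroup M] [Module k M] [Module (∀ i, D i) M] [Module (∀ i, D i)ᵐᵒᵖ M]
  [IsScalarTower k (∀ i, D i) M] [IsScalarTower k (∀ i, D i)ᵐᵒᵖ M]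

/-- The subspace `eᵢ M eⱼ` of `M`, where `eᵢ` is the idempotent of the factor `D i`. -/
def idempotentPart (i j : ι) : Submodule k M :=
  LinearMap.range ((DistribSMul.toLinearMap k M (Pi.single i 1 : ∀ i, D i)).comp
    (DistribSMul.toLinearMap k M (op (Pi.single j 1 : ∀ i, D i))))

/-- The matrix `C = 2 - D⁻¹ (R + Rᵗ)` of `T_A(M)` for `A = ∏ D i`, where `D` is the diagonal
matrix of the `dim D i` and `R` is the matrix of the `dim eᵢ M eⱼ`. -/
noncomputable def cartanMatrix : Matrix ι ι ℚ := fun i j =>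
  (if i = j then 2 else 0) -
    ((Module.finrank k (idempotentPart k D M i j) : ℚ)
      + Module.finrank k (idempotentPart k D M j i)) / Module.finrank k (D i)

end Dynkin

/-! ## Cartan matrices of Dynkin type -/

section DynkinNumerics

/-! Write `N = M ⊕ DM`. The argument has two halves, and Dynkin type enters only through the first.

Finite-dimensionality of `Π`. Let `X` be a finite-dimensional cyclic `Π`-module. The maps `Hom_A(X,
X) → Hom_A(X ⊗ N, X) → Hom_A(X, X)`, commutator followed by contraction with the canonical element
`ρ - ℓ`, form a complex because `ρ - ℓ` acts as zero on `X`. The kernel of the first map is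
`End_Π(X)`. A generator of `X` bounds both this kernel and the cokernel of the second map by `dim
X`. Hence `2 dim Hom_A(X, X) - dim Hom_A(X ⊗ N, X) ≤ 2 dim X`
(`BimoduleForm.two_mul_finrank_end_le`). In terms of the multiplicities `u i` of the simple
`A`-modules in `X`, the left side is at least `∑ u i * B i j * u j`, where `B` is the symmetrised
Cartan matrix, and the right side is at most a linear form in `u`. As `B` is positive definite, `dim
X` is bounded (`exists_finrank_cyclic_le`). Applied to the quotients of `Π` by the elements of path
length at least `n`, this leaves only finitely many nonzero graded components.

The isomorphism. The form `σ` identifies `DΠ` with the homomorphisms of left `A`-modules `Π → A`,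
and the alternating form on `N` makes `N` self-dual over `A` with canonical element `ρ - ℓ`. Since
`Π` is finitely generated projective over the semisimple ring `A`, evaluation identifies `X ⊗_A Π`
with `Hom_A(DΠ, X)` and `X ⊗_A N ⊗_A Π` with `Hom_A(DΠ ⊗_A N, X)`. Under these identifications the
left hand map sends `f` to `θ ⊗ n ↦ f(θ) n - f(θ n)` (`Preprojective.evalMiddle_leftMap`). As `Π` is
generated by `A` and `N`, the kernel is `Hom_Π(DΠ, X)`; evaluation is natural in `X`. -/

theorem Fin.sum_ite_val_eq (n m : ℕ) (g : ℕ → ℤ) :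
    (∑ j : Fin n, if j.val = m then g j.val else 0) = if m < n then g m else 0 := by
  rw [Fin.sum_univ_eq_sum_range (fun j => if j = m then g j else 0) n]
  simp

/-- The value of a row of a tridiagonal matrix with diagonal entry `2` at a vector `g`. -/
theorem Fin.sum_tridiagonal_row {n : ℕ} (i : Fin n) (p q : ℤ) (c : Fin n → ℤ) (g : ℕ → ℤ)
    (hc : ∀ j, c j = if i.val = j.val then 2 else if i.val + 1 = j.val then -p
      else if j.val + 1 = i.val then -q else 0) :
    ∑ j, c j * g j = 2 * g i - (if i.val + 1 < n then p * g (i.val + 1) else 0)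
      - (if i.val = 0 then 0 else q * g (i.val - 1)) := by
  -- At `i = 0` the truncated `i - 1` is `0` and would hit the diagonal; the inner test removes that
  -- contribution.
  have h : ∀ j : Fin n, c j * g j
      = (if j.val = i.val then 2 * g j.val else 0)
        - (if j.val = i.val + 1 then p * g j.val else 0)
        - (if j.val = i.val - 1 then (if i.val = 0 then 0 else q * g j.val) else 0) := by
    intro j
    rw [hc]
    split_ifs <;> first | omega | ring
  simp only [h, Finset.sum_sub_distrib]
  rw [Fin.sum_ite_val_eq n _ (fun j => 2 * g j), Fin.sum_ite_val_eq n _ (fun j => p * g j),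
    Fin.sum_ite_val_eq n _ (fun j => if i.val = 0 then 0 else q * g j)]
  have := i.2
  split_ifs <;> omega

/-- A positive vector with positive image certifies finite type: for a symmetrisable matrix with
nonpositive off-diagonal entries it yields positive definiteness. The quadratic sequence here has
constant second difference `-2` and vanishes just outside both ends, so every row has value `2`. -/
theorem CartanMatrix.exists_pos_A (n : ℕ) :
    ∃ z : Fin n → ℤ, (∀ i, 0 < z i) ∧ ∀ i, 0 < ∑ j, CartanMatrix.A n i j * z j := by
  refine ⟨fun i => ((i.val : ℤ) + 1) * (n - i.val), fun i => ?_, fun i => ?_⟩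
  · have : (i.val : ℤ) < n := by exact_mod_cast i.2
    exact mul_pos (by positivity) (by linarith)
  · rw [Fin.sum_tridiagonal_row i 1 1 _ (fun i : ℕ => ((i : ℤ) + 1) * (n - i)) (fun j => by
      simp only [CartanMatrix.A, Matrix.of_apply, Fin.ext_iff]
      split_ifs <;> omega)]
    obtain ⟨i, hi⟩ := i
    obtain ⟨m, rfl⟩ := Nat.exists_eq_add_of_lt hi
    rcases i with _ | i <;> dsimp only <;> split_ifs <;> first | omega | (push_cast; nlinarith)

theorem CartanMatrix.exists_pos_C (n : ℕ) :
    ∃ z : Fin n → ℤ, (∀ i, 0 < z i) ∧ ∀ i, 0 < ∑ j, CartanMatrix.C n i j * z j := by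
  -- The first half of the vector for `A_{2n}`, which is symmetric about its middle edge. The last
  -- row, with entry `-2`, takes the value `4`.
  refine ⟨fun i => ((i.val : ℤ) + 1) * (2 * n - i.val), fun i => ?_, fun i => ?_⟩
  · have : (i.val : ℤ) < n := by exact_mod_cast i.2
    exact mul_pos (by positivity) (by linarith)
  · rw [Fin.sum_tridiagonal_row i 1 (if i.val = n - 1 then 2 else 1) _
      (fun i : ℕ => ((i : ℤ) + 1) * (2 * n - i)) (fun j => by
      simp only [CartanMatrix.C, Matrix.of_apply, Fin.ext_iff]
      split_ifs <;> omega)]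
    obtain ⟨i, hi⟩ := i
    obtain ⟨m, rfl⟩ := Nat.exists_eq_add_of_lt hi
    rcases i with _ | i <;> rcases m with _ | m <;> dsimp only <;> split_ifs <;>
      first | omega | (push_cast; nlinarith)

theorem CartanMatrix.exists_pos_B (n : ℕ) :
    ∃ z : Fin n → ℤ, (∀ i, 0 < z i) ∧ ∀ i, 0 < ∑ j, CartanMatrix.B n i j * z j := by
  -- Twice the vector used for `C_n`, with the last entry left undoubled to compensate for the entry
  -- `-2` in the row before the last.
  set g : ℕ → ℤ := fun i => if i + 1 = n then (n : ℤ) * (n + 1)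
    else 2 * ((i : ℤ) + 1) * (2 * n - i) with hg
  refine ⟨fun i => g i, fun i => ?_, fun i => ?_⟩
  · have : (i.val : ℤ) < n := by exact_mod_cast i.2
    have h0 : (0 : ℤ) ≤ i.val := by positivity
    simp only [hg]
    split_ifs
    · exact mul_pos (by linarith) (by linarith)
    · exact mul_pos (by positivity) (by linarith)
  · rw [Fin.sum_tridiagonal_row i (if i.val + 2 = n then 2 else 1) 1 _ g (fun j => by
      simp only [CartanMatrix.B, Matrix.of_apply, Fin.ext_iff]
      split_ifs <;> omega)]
    obtain ⟨i, hi⟩ := i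
    obtain ⟨m, rfl⟩ := Nat.exists_eq_add_of_lt hi
    simp only [hg]
    -- Here `m` is the distance to the last vertex; distances `0` and `1` are the exceptional rows.
    rcases i with _ | i <;> rcases m with _ | _ | m <;> split_ifs <;>
      first | omega | (push_cast; nlinarith)

theorem CartanMatrix.exists_pos_D (n : ℕ) :
    ∃ z : Fin n → ℤ, (∀ i, 0 < z i) ∧ ∀ i, 0 < ∑ j, CartanMatrix.D n i j * z j := by
  rcases le_or_gt n 2 with hn | hn
  · refine ⟨fun _ => 1, fun _ => one_pos, fun i => ?_⟩
    have h : ∀ j, CartanMatrix.D n i j * 1 = if i = j then 2 else 0 := by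
      intro j
      simp [CartanMatrix.D, hn]
    simp only [h]
    simp
  obtain ⟨l, rfl⟩ := Nat.exists_eq_add_of_lt hn
  -- The diagram `D_{l+3}` folds onto `B_{l+2}`: this is the vector for `B_{l+2}`, with its last
  -- entry placed on both ends `l + 1` and `l + 2` of the fork at `l`.
  set g : ℕ → ℤ := fun i => if i < l + 1 then 2 * ((i : ℤ) + 1) * (2 * l + 4 - i)
    else ((l : ℤ) + 2) * (l + 3) with hg
  refine ⟨fun i => g i, fun i => ?_, fun i => ?_⟩
  · simp only [hg]
    split_ifs with h
    · have : (i.val : ℤ) < l + 1 := by exact_mod_cast h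
      exact mul_pos (by positivity) (by linarith)
    · positivity
  · obtain ⟨i, hi⟩ := i
    have hcases : i < l ∨ i = l ∨ i = l + 1 ∨ i = l + 2 := by omega
    rcases hcases with h | rfl | rfl | rfl
    · rw [Fin.sum_tridiagonal_row ⟨i, hi⟩ 1 1 _ g (fun j => by
        simp only [CartanMatrix.D, Matrix.of_apply, Fin.ext_iff]
        split_ifs <;> omega)]
      obtain ⟨m, rfl⟩ := Nat.exists_eq_add_of_lt h
      simp only [hg]
      rcases i with _ | i <;> split_ifs <;> first | omega | (push_cast; nlinarith)
    · have h : ∀ j : Fin (2 + i + 1), CartanMatrix.D (2 + i + 1) ⟨i, hi⟩ j * g j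
          = (if j.val = i then 2 * g j.val else 0) - (if j.val = i + 1 then g j.val else 0)
            - (if j.val = i + 2 then g j.val else 0)
            - (if j.val = i - 1 then (if i = 0 then 0 else g j.val) else 0) := by
        intro j
        simp only [CartanMatrix.D, Matrix.of_apply, Fin.ext_iff]
        split_ifs <;> omega
      simp only [h, Finset.sum_sub_distrib]
      rw [Fin.sum_ite_val_eq _ _ (fun j => 2 * g j), Fin.sum_ite_val_eq _ _ g,
        Fin.sum_ite_val_eq _ _ g, Fin.sum_ite_val_eq _ _ (fun j => if i = 0 then 0 else g j)]
      simp only [hg]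
      rcases i with _ | i <;> split_ifs <;> first | omega | (push_cast; nlinarith)
    -- The upper coefficient is `0` because the two ends of the fork are not joined.
    · rw [Fin.sum_tridiagonal_row ⟨l + 1, hi⟩ 0 1 _ g (fun j => by
        simp only [CartanMatrix.D, Matrix.of_apply, Fin.ext_iff]
        split_ifs <;> omega)]
      simp only [hg]
      split_ifs <;> first | omega | (push_cast; nlinarith)
    · have h : ∀ j : Fin (2 + l + 1), CartanMatrix.D (2 + l + 1) ⟨l + 2, hi⟩ j * g j
          = (if j.val = l + 2 then 2 * g j.val else 0) - (if j.val = l then g j.val else 0) := by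
        intro j
        simp only [CartanMatrix.D, Matrix.of_apply, Fin.ext_iff]
        split_ifs <;> omega
      simp only [h, Finset.sum_sub_distrib]
      rw [Fin.sum_ite_val_eq _ _ (fun j => 2 * g j), Fin.sum_ite_val_eq _ _ g]
      simp only [hg]
      split_ifs <;> first | omega | nlinarith

theorem DynkinDiagram.exists_pos (t : DynkinDiagram) :
    ∃ z : Fin t.rank → ℤ, (∀ i, 0 < z i) ∧ ∀ i, 0 < ∑ j, t.cartan i j * z j := by
  cases t with
  | A n => exact CartanMatrix.exists_pos_A n
  | B n => exact CartanMatrix.exists_pos_B n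
  | C n => exact CartanMatrix.exists_pos_C n
  | D n => exact CartanMatrix.exists_pos_D n
  -- For the exceptional types the vector solves `C z = (2, …, 2)`; its entries are the coefficients
  -- of the sum of the positive roots or coroots.
  | E₆ =>
    exact ⟨(![16, 22, 30, 42, 30, 16] : Fin 6 → ℤ),
      (by decide : ∀ i, 0 < (![16, 22, 30, 42, 30, 16] : Fin 6 → ℤ) i),
      (by decide : ∀ i, 0 < ∑ j, CartanMatrix.E₆ i j * (![16, 22, 30, 42, 30, 16] : Fin 6 → ℤ) j)⟩
  | E₇ =>
    exact ⟨(![34, 49, 66, 96, 75, 52, 27] : Fin 7 → ℤ),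
      (by decide : ∀ i, 0 < (![34, 49, 66, 96, 75, 52, 27] : Fin 7 → ℤ) i),
      (by decide : ∀ i, 0 < ∑ j, CartanMatrix.E₇ i j *
        (![34, 49, 66, 96, 75, 52, 27] : Fin 7 → ℤ) j)⟩
  | E₈ =>
    exact ⟨(![92, 136, 182, 270, 220, 168, 114, 58] : Fin 8 → ℤ),
      (by decide : ∀ i, 0 < (![92, 136, 182, 270, 220, 168, 114, 58] : Fin 8 → ℤ) i),
      (by decide : ∀ i, 0 < ∑ j, CartanMatrix.E₈ i j *
        (![92, 136, 182, 270, 220, 168, 114, 58] : Fin 8 → ℤ) j)⟩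
  | F₄ =>
    exact ⟨(![22, 42, 30, 16] : Fin 4 → ℤ),
      (by decide : ∀ i, 0 < (![22, 42, 30, 16] : Fin 4 → ℤ) i),
      (by decide : ∀ i, 0 < ∑ j, CartanMatrix.F₄ i j * (![22, 42, 30, 16] : Fin 4 → ℤ) j)⟩
  | G₂ =>
    exact ⟨(![10, 6] : Fin 2 → ℤ),
      (by decide : ∀ i, 0 < (![10, 6] : Fin 2 → ℤ) i),
      (by decide : ∀ i, 0 < ∑ j, CartanMatrix.G₂ i j * (![10, 6] : Fin 2 → ℤ) j)⟩

theorem IsDynkinCartan.exists_pos {ι : Type} [Fintype ι] {C : Matrix ι ι ℚ}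
    (hC : IsDynkinCartan C) :
    ∃ z : ι → ℚ, (∀ i, 0 < z i) ∧ ∀ i, 0 < ∑ j, C i j * z j := by
  obtain ⟨m, t, e, rfl⟩ := hC
  choose z hz hCz using fun s => (t s).exists_pos
  refine ⟨fun i => (z (e i).1 (e i).2 : ℚ), fun i => Int.cast_pos.2 (hz _ _), fun i => ?_⟩
  have hsum := e.sum_comp (fun p : (s : Fin m) × Fin (t s).rank =>
    ((Matrix.blockDiagonal' (fun s => (t s).cartan) (e i) p : ℤ) : ℚ) * (z p.1 p.2 : ℚ))
  refine lt_of_lt_of_eq ?_ hsum.symm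
  rw [Fintype.sum_sigma]
  obtain ⟨s, a⟩ := e i
  rw [Finset.sum_eq_single s]
  · simp only [Matrix.blockDiagonal'_apply_eq]
    exact_mod_cast hCz s a
  · intro s' _ hs
    refine Finset.sum_eq_zero fun b _ => ?_
    rw [Matrix.blockDiagonal'_apply_ne _ _ _ (Ne.symm hs)]
    simp
  · simp

/-- A symmetric matrix with nonpositive off-diagonal entries which maps some positive vector to a
positive vector is positive definite. -/
theorem Matrix.exists_pos_mul_sum_sq_le {ι : Type} [Fintype ι] (B : ι → ι → ℚ)
    (hsymm : ∀ i j, B i j = B j i) (hoff : ∀ i j, i ≠ j → B i j ≤ 0)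
    (z : ι → ℚ) (hz : ∀ i, 0 < z i) (u : ι → ℚ) :
    ∑ i, (∑ j, B i j * z j) / z i * u i ^ 2 ≤ ∑ i, ∑ j, u i * B i j * u j := by
  -- The difference of the two sides comes from the identity `uᵀ B u = ∑ (B z)ᵢ / zᵢ * uᵢ² - ½ ∑ Bᵢⱼ
  -- zᵢ zⱼ (uᵢ / zᵢ - uⱼ / zⱼ)²`, in which the diagonal terms of the last sum vanish.
  have key : ∀ i j, B i j * z i * z j * (u i / z i - u j / z j) ^ 2 ≤ 0 := by
    intro i j
    by_cases h : i = j
    · subst h; simp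
    · have h1 : B i j * (z i * z j) ≤ 0 :=
        mul_nonpos_of_nonpos_of_nonneg (hoff i j h) (mul_pos (hz i) (hz j)).le
      have := mul_nonpos_of_nonpos_of_nonneg h1 (sq_nonneg (u i / z i - u j / z j))
      linarith
  have expand : ∀ i j, B i j * z i * z j * (u i / z i - u j / z j) ^ 2
      = B i j * z j / z i * u i ^ 2 + B j i * z i / z j * u j ^ 2 - 2 * (u i * B i j * u j) := by
    intro i j
    have := (hz i).ne'
    have := (hz j).ne'
    rw [hsymm j i]
    field_simp
    ring
  have hsum : ∑ i, ∑ j, (B i j * z j / z i * u i ^ 2 + B j i * z i / z j * u j ^ 2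
      - 2 * (u i * B i j * u j)) ≤ 0 :=
    Finset.sum_nonpos fun i _ => Finset.sum_nonpos fun j _ => (expand i j) ▸ key i j
  simp only [Finset.sum_sub_distrib, Finset.sum_add_distrib, ← Finset.mul_sum] at hsum
  rw [Finset.sum_comm (f := fun i j => B j i * z i / z j * u j ^ 2)] at hsum
  have e : ∀ i, (∑ j, B i j * z j) / z i * u i ^ 2 = ∑ j, B i j * z j / z i * u i ^ 2 := by
    intro i
    rw [Finset.sum_div, Finset.sum_mul]
  simp only [e]
  linarith

/-- The set of nonnegative vectors on which a positive definite form is bounded by a linear form is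
bounded. -/
theorem Matrix.exists_bound_of_form_le {ι : Type} [Fintype ι] (B : ι → ι → ℚ)
    (hsymm : ∀ i j, B i j = B j i) (hoff : ∀ i j, i ≠ j → B i j ≤ 0)
    (z : ι → ℚ) (hz : ∀ i, 0 < z i) (hBz : ∀ i, 0 < ∑ j, B i j * z j) (l : ι → ℚ) :
    ∃ K : ℚ, ∀ u : ι → ℚ, ∑ i, ∑ j, u i * B i j * u j ≤ ∑ i, l i * u i →
      ∑ i, l i * u i ≤ K := by
  set c : ι → ℚ := fun i => (∑ j, B i j * z j) / z i with hc
  have hcpos : ∀ i, 0 < c i := fun i => div_pos (hBz i) (hz i)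
  -- Completing squares gives `2 l·u ≤ ∑ cᵢ uᵢ² + ∑ lᵢ² / cᵢ`, and the first sum is at most `l·u`.
  refine ⟨∑ i, l i ^ 2 / c i, fun u hu => ?_⟩
  have h1 := (Matrix.exists_pos_mul_sum_sq_le B hsymm hoff z hz u).trans hu
  have h2 : ∀ i, 2 * (l i * u i) ≤ c i * u i ^ 2 + l i ^ 2 / c i := by
    intro i
    have h3 : c i * u i ^ 2 + l i ^ 2 / c i - 2 * (l i * u i)
        = (c i * u i - l i) ^ 2 / c i := by
      have := (hcpos i).ne'
      field_simp
      ring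
    have h4 : 0 ≤ (c i * u i - l i) ^ 2 / c i := div_nonneg (sq_nonneg _) (hcpos i).le
    linarith
  have h5 := Finset.sum_le_sum fun i (_ : i ∈ Finset.univ) => h2 i
  rw [Finset.sum_add_distrib, ← Finset.mul_sum] at h5
  linarith

end DynkinNumerics

/-! ## Bimodules with a nondegenerate form -/

section DualBasis

theorem Module.exists_left_dual_basis (A Y : Type u) [Ring A] [IsSemisimpleRing A]
    [AddCommGroup Y] [Module A Y] [Module.Finite A Y] :
    ∃ (n : ℕ) (y : Fin n → Y) (h : Fin n → (Y →ₗ[A] A)), ∀ x, ∑ i, h i x • y i = x := by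
  have := Module.projective_of_isSemisimpleRing A Y
  obtain ⟨n, f, g, -, -, hfg⟩ := Module.Finite.exists_comp_eq_id_of_projective A Y
  refine ⟨n, fun i => f (Pi.single i 1), fun i => (LinearMap.proj i).comp g, fun x => ?_⟩
  have h1 : f (g x) = x := LinearMap.congr_fun hfg x
  conv_rhs => rw [← h1, pi_eq_sum_univ' (g x)]
  simp only [map_sum, map_smul]
  rfl

theorem Module.exists_right_dual_basis (A X : Type u) [Ring A] [IsSemisimpleRing A]
    [AddCommGroup X] [Module Aᵐᵒᵖ X] [Module.Finite Aᵐᵒᵖ X] :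
    ∃ (n : ℕ) (y : Fin n → X) (h : Fin n → (X →ₗ[Aᵐᵒᵖ] A)), ∀ x, ∑ i, op (h i x) • y i = x := by
  obtain ⟨n, y, h, hy⟩ := Module.exists_left_dual_basis Aᵐᵒᵖ X
  exact ⟨n, y, fun i => { toFun := fun x => unop (h i x)
                          map_add' := fun a b => by simp
                          map_smul' := fun a b => by simp [MulOpposite.smul_eq_mul_unop] }, hy⟩

end DualBasis

/-- A bimodule `N` with an `A`-valued form for which `∑ u ⊗ v` is the canonical element. -/
structure BimoduleForm (A N : Type u) [Ring A] [AddCommGroup N] [Module A N]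
    [Module Aᵐᵒᵖ N] where
  form : N →+ N →+ A
  smul_left : ∀ (a : A) (n n' : N), form (a • n) n' = a * form n n'
  smul_right : ∀ (a : A) (n n' : N), form n (op a • n') = form n n' * a
  balanced : ∀ (a : A) (n n' : N), form (op a • n) n' = form n (a • n')
  idx : Type
  fintype : Fintype idx
  u : idx → N
  v : idx → N
  sum_u : ∀ n, ∑ s, op (form (v s) n) • u s = n
  sum_v : ∀ n, ∑ s, form n (u s) • v s = n

namespace BimoduleForm

attribute [instance] BimoduleForm.fintype

variable {A N : Type u} [Ring A] [AddCommGroup N] [Module A N] [Module Aᵐᵒᵖ N]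
  (B : BimoduleForm A N)

/-- The canonical element `∑ u ⊗ v` commutes with the elements of `A`. -/
theorem canonical_comm {Z : Type u} [AddCommGroup Z] (G : N →+ N →+ Z)
    (hG : ∀ (n : N) (a : A) (n' : N), G (op a • n) n' = G n (a • n')) (a : A) :
    ∑ s, G (a • B.u s) (B.v s) = ∑ s, G (B.u s) (op a • B.v s) := by
  have h1 : ∀ s, G (a • B.u s) (B.v s)
      = ∑ t, G (B.u t) (B.form (op a • B.v t) (B.u s) • B.v s) := by
    intro s
    conv_lhs => rw [← B.sum_u (a • B.u s)]
    simp only [map_sum, AddMonoidHom.finsetSum_apply, hG, B.balanced]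
  simp only [h1]
  rw [Finset.sum_comm]
  simp only [← map_sum, B.sum_v]

/-! ### The Euler form inequality for cyclic modules -/

section EulerForm

variable {k : Type u} [Field k] [Algebra k A] [Module k N] [IsScalarTower k A N]
  [IsScalarTower k Aᵐᵒᵖ N]
  {X : Type u} [AddCommGroup X] [Module k X] [Module Aᵐᵒᵖ X] [IsScalarTower k Aᵐᵒᵖ X]

variable (k A N X) in
/-- The space of homomorphisms of right `A`-modules `X ⊗_A N → X`. -/
def actions : Submodule k (X →ₗ[k] N →ₗ[k] X) where
  carrier := {f | (∀ (x : X) (a : A) (n : N), f (op a • x) n = f x (a • n)) ∧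
    ∀ (x : X) (n : N) (a : A), f x (op a • n) = op a • f x n}
  add_mem' := by
    rintro f g ⟨hf, hf'⟩ ⟨hg, hg'⟩
    exact ⟨fun x a n => by simp [hf, hg], fun x n a => by simp [hf', hg']⟩
  zero_mem' := ⟨fun x a n => by simp, fun x n a => by simp⟩
  smul_mem' := by
    rintro c f ⟨hf, hf'⟩
    exact ⟨fun x a n => by simp [hf], fun x n a => by simp [hf', smul_comm c]⟩

variable (k) in
/-- The homomorphism `w ↦ x h(w)`. -/
def rankOne (x : X) :
    (X →ₗ[Aᵐᵒᵖ] A) →ₗ[k] (X →ₗ[Aᵐᵒᵖ] X) where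
  toFun h :=
    { toFun := fun w => op (h w) • x
      map_add' := fun w w' => by simp [add_smul]
      map_smul' := fun a w => by simp [mul_smul, MulOpposite.smul_eq_mul_unop] }
  map_add' h h' := by ext w; simp [add_smul]
  map_smul' c h := by ext w; simp

theorem rankOne_apply (x : X) (h : X →ₗ[Aᵐᵒᵖ] A) (w : X) : rankOne k x h w = op (h w) • x := rfl

theorem rankOne_add (x y : X) (h : X →ₗ[Aᵐᵒᵖ] A) :
    rankOne k (x + y) h = rankOne k x h + rankOne k y h := by
  ext w
  simp [rankOne_apply]

variable (act : actions A N k X)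

/-- The map sending `φ` to `x ⊗ n ↦ φ(x) n - φ(x n)`. -/
def commutatorMap : (X →ₗ[Aᵐᵒᵖ] X) →ₗ[k] actions A N k X where
  toFun φ := ⟨act.1 ∘ₗ φ.restrictScalars k - act.1.compr₂ (φ.restrictScalars k),
    fun x a n => by simp [act.2.1], fun x n a => by simp [act.2.2, smul_sub]⟩
  map_add' φ φ' := by
    ext x n
    simp only [LinearMap.sub_apply, LinearMap.comp_apply, LinearMap.compr₂_apply,
      LinearMap.coe_restrictScalars, LinearMap.add_apply, map_add, Submodule.coe_add]
    abel
  map_smul' c φ := by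
    ext x n
    simp [smul_sub]

theorem commutatorMap_apply (φ : X →ₗ[Aᵐᵒᵖ] X) (x : X) (n : N) :
    (commutatorMap act φ).1 x n = act.1 (φ x) n - φ (act.1 x n) := rfl

theorem canonical_comm' {Z : Type u} [AddCommGroup Z] (G : N → N → Z)
    (hadd : ∀ n n' n'', G (n + n') n'' = G n n'' + G n' n'')
    (hadd' : ∀ n n' n'', G n (n' + n'') = G n n' + G n n'')
    (hG : ∀ (n : N) (a : A) (n' : N), G (op a • n) n' = G n (a • n')) (a : A) :
    ∑ s, G (a • B.u s) (B.v s) = ∑ s, G (B.u s) (op a • B.v s) :=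
  B.canonical_comm (AddMonoidHom.mk' (fun n => AddMonoidHom.mk' (fun n' => G n n')
    (hadd' n)) (fun n n' => AddMonoidHom.ext fun n'' => hadd n n' n'')) hG a

/-- The map sending `ψ` to `x ↦ ∑ ψ(x, u) v + ψ(x u, v)`. -/
def contractionMap : actions A N k X →ₗ[k] (X →ₗ[Aᵐᵒᵖ] X) where
  toFun ψ :=
    { toFun := fun x => ∑ s, (act.1 (ψ.1 x (B.u s)) (B.v s) + ψ.1 (act.1 x (B.u s)) (B.v s))
      map_add' := fun x y => by
        simp only [map_add, LinearMap.add_apply, ← Finset.sum_add_distrib]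
        exact Finset.sum_congr rfl fun s _ => by abel
      map_smul' := fun a x => by
        obtain ⟨a⟩ := a
        change ∑ s, (act.1 (ψ.1 (op a • x) (B.u s)) (B.v s)
            + ψ.1 (act.1 (op a • x) (B.u s)) (B.v s))
          = op a • ∑ s, (act.1 (ψ.1 x (B.u s)) (B.v s) + ψ.1 (act.1 x (B.u s)) (B.v s))
        simp only [ψ.2.1, act.2.1]
        -- Right `A`-linearity of the contraction is the centrality of the canonical element: `a`
        -- moves from the left of `u` to the right of `v`.
        rw [B.canonical_comm' (fun n n' => act.1 (ψ.1 x n) n' + ψ.1 (act.1 x n) n')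
          (fun n n' n'' => by simp only [map_add, LinearMap.add_apply]; abel)
          (fun n n' n'' => by simp only [map_add]; abel)
          (fun n b n' => by simp only [act.2.1, ψ.2.1, act.2.2, ψ.2.2])]
        simp only [act.2.2, ψ.2.2, Finset.smul_sum, smul_add] }
  map_add' ψ ψ' := by
    ext x
    simp only [LinearMap.coe_mk, AddHom.coe_mk, Submodule.coe_add, LinearMap.add_apply, map_add,
      ← Finset.sum_add_distrib]
    exact Finset.sum_congr rfl fun s _ => by abel
  map_smul' c ψ := by
    ext x
    simp [Finset.smul_sum, smul_add]

theorem contractionMap_apply (ψ : actions A N k X) (x : X) :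
    B.contractionMap act ψ x
      = ∑ s, (act.1 (ψ.1 x (B.u s)) (B.v s) + ψ.1 (act.1 x (B.u s)) (B.v s)) := rfl

/-- The cross terms `φ(x u) v` cancel, and what remains is `φ(x) u v - φ(x u v)`, both summed over
the canonical element and hence zero by `hrel`. -/
theorem contractionMap_commutatorMap
    (hrel : ∀ x, ∑ s, act.1 (act.1 x (B.u s)) (B.v s) = 0) (φ : X →ₗ[Aᵐᵒᵖ] X) :
    B.contractionMap act (commutatorMap act φ) = 0 := by
  ext x
  rw [contractionMap_apply]
  simp only [commutatorMap_apply]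
  have h : ∀ s, act.1 (act.1 (φ x) (B.u s) - φ (act.1 x (B.u s))) (B.v s)
      + (act.1 (φ (act.1 x (B.u s))) (B.v s) - φ (act.1 (act.1 x (B.u s)) (B.v s)))
      = act.1 (act.1 (φ x) (B.u s)) (B.v s) - φ (act.1 (act.1 x (B.u s)) (B.v s)) := by
    intro s
    simp only [map_sub, LinearMap.sub_apply]
    abel
  simp only [h, Finset.sum_sub_distrib, ← map_sum, hrel]
  simp

theorem form_ksmul_left (c : k) (n n' : N) : B.form (c • n) n' = c • B.form n n' := by
  rw [← algebraMap_smul A c n, B.smul_left, Algebra.smul_def]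

theorem form_ksmul_right (c : k) (n n' : N) : B.form n (c • n') = c • B.form n n' := by
  have h : c • n' = op (algebraMap k A c) • n' := (algebraMap_smul Aᵐᵒᵖ c n').symm
  rw [h, B.smul_right, Algebra.smul_def, Algebra.commutes]

theorem _root_.LinearMap.map_ksmul_of_op (h : X →ₗ[Aᵐᵒᵖ] A) (c : k) (x : X) :
    h (c • x) = c • h x := (h.restrictScalars k).map_smul c x

/-- The action `x ⊗ n ↦ y {n' h(x), n}`. -/
def formAction (y : X) (n' : N) (h : X →ₗ[Aᵐᵒᵖ] A) : actions A N k X :=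
  ⟨LinearMap.mk₂ k (fun x n => op (B.form (op (h x) • n') n) • y)
    (fun x x' n => by simp [add_smul])
    (fun c x n => by
      simp only [LinearMap.map_ksmul_of_op, op_smul, smul_assoc, B.form_ksmul_left])
    (fun x n n' => by simp [add_smul])
    (fun c x n => by simp only [op_smul, smul_assoc, B.form_ksmul_right]),
    fun x a n => by
      simp only [LinearMap.mk₂_apply, map_smul, MulOpposite.smul_eq_mul_unop, unop_op, mul_smul, B.balanced],
    fun x n a => by
      simp only [LinearMap.mk₂_apply, B.smul_right, op_mul, mul_smul]⟩

theorem formAction_apply (y : X) (n' : N) (h : X →ₗ[Aᵐᵒᵖ] A) (x : X) (n : N) :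
    (B.formAction (k := k) y n' h).1 x n = op (B.form (op (h x) • n') n) • y := rfl

/-- The homomorphism `w ↦ ∑ {n h(w u), v}`. -/
def shiftHom (n : N) (h : X →ₗ[Aᵐᵒᵖ] A) : X →ₗ[Aᵐᵒᵖ] A where
  toFun w := ∑ s, B.form (op (h (act.1 w (B.u s))) • n) (B.v s)
  map_add' w w' := by
    simp only [map_add, LinearMap.add_apply, MulOpposite.op_add, add_smul, AddMonoidHom.add_apply,
      Finset.sum_add_distrib]
  map_smul' a w := by
    obtain ⟨a⟩ := a
    change ∑ s, B.form (op (h (act.1 (op a • w) (B.u s))) • n) (B.v s)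
      = (∑ s, B.form (op (h (act.1 w (B.u s))) • n) (B.v s)) * a
    simp only [act.2.1]
    rw [B.canonical_comm' (fun n' n'' => B.form (op (h (act.1 w n')) • n) n'')
      (fun n₁ n₂ n₃ => by simp [add_smul]) (fun n₁ n₂ n₃ => by simp)
      (fun n₁ b n₂ => by
        simp only [act.2.2, map_smul, MulOpposite.smul_eq_mul_unop, unop_op, op_mul, mul_smul,
          B.balanced])]
    simp only [B.smul_right, Finset.sum_mul]

/-- Modulo the range of the contraction, a rank one map with image generated by `y n` becomes one
with image generated by `y`. This allows all rank one maps to be traced back to a generator of `X`.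
-/
theorem contractionMap_formAction (y : X) (n : N) (h : X →ₗ[Aᵐᵒᵖ] A) :
    B.contractionMap act (B.formAction y n h)
      = rankOne k (act.1 y n) h + rankOne k y (B.shiftHom act n h) := by
  ext w
  rw [contractionMap_apply, LinearMap.add_apply, rankOne_apply, rankOne_apply,
    Finset.sum_add_distrib]
  congr 1
  · simp only [formAction_apply, act.2.1, ← map_sum, B.sum_v, act.2.2]
  · change _ = op (∑ s, B.form (op (h (act.1 w (B.u s))) • n) (B.v s)) • y
    simp only [formAction_apply, Finset.op_sum, Finset.sum_smul]

/-- Left multiplication by an element of `A` on `Hom_A(X, A)`. -/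
def mulHom (a : A) (h : X →ₗ[Aᵐᵒᵖ] A) : X →ₗ[Aᵐᵒᵖ] A where
  toFun x := a * h x
  map_add' x y := by simp [mul_add]
  map_smul' b x := by simp [MulOpposite.smul_eq_mul_unop, mul_assoc]

theorem rankOne_smul (a : A) (y : X) (h : X →ₗ[Aᵐᵒᵖ] A) :
    rankOne k (op a • y) h = rankOne k y (mulHom a h) := by
  ext w
  simp only [rankOne_apply, ← mul_smul]
  rfl

/-- A counterpart of the fact that an endomorphism is determined by its value on a generator. The
`x` all of whose rank one maps lie in the sum form an `A`-submodule which contains `x₀` and, by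
`contractionMap_formAction`, is stable under `N`; so it is all of `X`. Rank one maps span `Hom_A(X,
X)` by a dual basis. -/
theorem range_contractionMap_sup [IsSemisimpleRing A] [Module.Finite Aᵐᵒᵖ X] (x₀ : X)
    (hgen : ∀ S : Submodule Aᵐᵒᵖ X, x₀ ∈ S → (∀ x ∈ S, ∀ n, act.1 x n ∈ S) → S = ⊤) :
    LinearMap.range (B.contractionMap act) ⊔ LinearMap.range (rankOne (A := A) k x₀) = ⊤ := by
  set Q := LinearMap.range (B.contractionMap act) ⊔ LinearMap.range (rankOne (A := A) k x₀)
    with hQ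
  have key : ∀ (x : X) (h : X →ₗ[Aᵐᵒᵖ] A), rankOne k x h ∈ Q := by
    let S : Submodule Aᵐᵒᵖ X :=
      { carrier := {x | ∀ h : X →ₗ[Aᵐᵒᵖ] A, rankOne k x h ∈ Q}
        add_mem' := fun {x y} hx hy h => by
          rw [rankOne_add]
          exact Q.add_mem (hx h) (hy h)
        zero_mem' := fun h => by
          have : rankOne k (0 : X) h = 0 := by ext w; simp [rankOne_apply]
          rw [this]
          exact Q.zero_mem
        smul_mem' := fun a x hx h => by
          obtain ⟨a⟩ := a
          exact (rankOne_smul (k := k) a x h) ▸ hx (mulHom a h) }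
    have hS : S = ⊤ := by
      refine hgen S (fun h => Submodule.mem_sup_right ⟨h, rfl⟩) fun x hx n h => ?_
      have e := B.contractionMap_formAction act x n h
      rw [← sub_eq_iff_eq_add] at e
      rw [← e]
      exact Q.sub_mem (Submodule.mem_sup_left ⟨_, rfl⟩) (hx _)
    intro x
    exact (hS ▸ Submodule.mem_top : x ∈ S)
  obtain ⟨n, y, h, hy⟩ := Module.exists_right_dual_basis A X
  rw [eq_top_iff]
  intro φ _
  have hφ : φ = ∑ i, rankOne k (φ (y i)) (h i) := by
    ext w
    conv_lhs => rw [← hy w]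
    simp [rankOne_apply]
  rw [hφ]
  exact Q.sum_mem fun i _ => key _ _

/-- The kernel consists of the endomorphisms commuting with `N`, and such an endomorphism is
determined by its value at the generator `x₀`. -/
theorem finrank_ker_commutatorMap_le [FiniteDimensional k X] (x₀ : X)
    (hgen : ∀ S : Submodule Aᵐᵒᵖ X, x₀ ∈ S → (∀ x ∈ S, ∀ n, act.1 x n ∈ S) → S = ⊤) :
    Module.finrank k (LinearMap.ker (commutatorMap act)) ≤ Module.finrank k X := by
  let ev : (X →ₗ[Aᵐᵒᵖ] X) →ₗ[k] X :=
    { toFun := fun φ => φ x₀, map_add' := fun _ _ => rfl, map_smul' := fun _ _ => rfl }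
  refine LinearMap.finrank_le_finrank_of_injective
    (f := ev.comp (LinearMap.ker (commutatorMap act)).subtype) ?_
  rw [injective_iff_map_eq_zero]
  rintro ⟨φ, hφ⟩ h0
  have hcomm : ∀ x n, act.1 (φ x) n = φ (act.1 x n) := fun x n => by
    have h1 : commutatorMap act φ = 0 := hφ
    have := congrArg (fun f : actions A N k X => f.1 x n) h1
    exact sub_eq_zero.1 this
  have h0' : φ x₀ = 0 := h0
  have hker : LinearMap.ker φ = ⊤ := by
    refine hgen _ h0' fun x hx n => ?_
    have hx' : φ x = 0 := hx
    change φ (act.1 x n) = 0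
    rw [← hcomm, hx', map_zero, LinearMap.zero_apply]
  exact Subtype.ext (LinearMap.ker_eq_top.1 hker)

/-- An instance of the inequality between the Euler form and the dimension of endomorphism
rings: for a cyclic module `X` with `X u v = 0`, we have
`2 dim Hom_A(X, X) ≤ dim Hom_A(X ⊗ N, X) + 2 dim X`. -/
theorem two_mul_finrank_end_le [IsSemisimpleRing A] [FiniteDimensional k N] [FiniteDimensional k X]
    (σ : SymmetrisingForm k A)
    (hrel : ∀ x, ∑ s, act.1 (act.1 x (B.u s)) (B.v s) = 0) (x₀ : X)
    (hgen : ∀ S : Submodule Aᵐᵒᵖ X, x₀ ∈ S → (∀ x ∈ S, ∀ n, act.1 x n ∈ S) → S = ⊤) :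
    2 * Module.finrank k (X →ₗ[Aᵐᵒᵖ] X)
      ≤ Module.finrank k (actions A N k X) + 2 * Module.finrank k X := by
  have : Module.Finite Aᵐᵒᵖ X := Module.Finite.of_restrictScalars_finite k Aᵐᵒᵖ X
  have hfin : FiniteDimensional k (X →ₗ[Aᵐᵒᵖ] X) :=
    FiniteDimensional.of_injective
      ({ toFun := fun φ => φ.restrictScalars k, map_add' := fun _ _ => rfl,
         map_smul' := fun _ _ => rfl } : (X →ₗ[Aᵐᵒᵖ] X) →ₗ[k] (X →ₗ[k] X))
      (fun φ φ' h => LinearMap.ext fun x => LinearMap.congr_fun h x)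
  -- Composition with `σ` embeds `Hom_A(X, A)` in `DX`, so the rank one maps through `x₀` span at
  -- most `dim X` dimensions.
  let dualMap : (X →ₗ[Aᵐᵒᵖ] A) →ₗ[k] (X →ₗ[k] k) :=
    { toFun := fun h => σ.toLinearMap.comp (h.restrictScalars k)
      map_add' := fun h h' => by ext x; simp
      map_smul' := fun c h => by ext x; simp }
  have hdual : Function.Injective dualMap := by
    rw [injective_iff_map_eq_zero]
    intro h h0
    ext x
    refine σ.nondegenerate _ fun b => ?_
    have h1 : σ.toLinearMap (h (op b • x)) = 0 := LinearMap.congr_fun h0 (op b • x)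
    rwa [map_smul, MulOpposite.smul_eq_mul_unop] at h1
  have hfin' : FiniteDimensional k (X →ₗ[Aᵐᵒᵖ] A) := FiniteDimensional.of_injective dualMap hdual
  have h1 : Module.finrank k (X →ₗ[Aᵐᵒᵖ] A) ≤ Module.finrank k X :=
    (LinearMap.finrank_le_finrank_of_injective hdual).trans_eq Subspace.dual_finrank_eq
  -- Rank-nullity for both maps of the complex: the rank of the commutator map is at most the
  -- nullity of the contraction, while the kernel of the first and the cokernel of the second have
  -- dimension at most `dim X`.
  have h2 := LinearMap.finrank_range_add_finrank_ker (K := k) (V := X →ₗ[Aᵐᵒᵖ] X)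
    (V₂ := actions A N k X) (commutatorMap act)
  have h3 := LinearMap.finrank_range_add_finrank_ker (K := k) (V := actions A N k X)
    (V₂ := X →ₗ[Aᵐᵒᵖ] X) (B.contractionMap act)
  have h4 : Module.finrank k (LinearMap.range (commutatorMap act))
      ≤ Module.finrank k (LinearMap.ker (B.contractionMap act)) := by
    refine Submodule.finrank_mono ?_
    rintro _ ⟨φ, rfl⟩
    exact B.contractionMap_commutatorMap act hrel φ
  have h5 := finrank_ker_commutatorMap_le act x₀ hgen
  have h6 := Submodule.finrank_add_le_finrank_add_finrank
    (LinearMap.range (B.contractionMap act)) (LinearMap.range (rankOne (A := A) k x₀))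
  rw [B.range_contractionMap_sup act x₀ hgen, finrank_top] at h6
  have h7 := LinearMap.finrank_range_le (rankOne (A := A) k x₀)
  omega

end EulerForm

end BimoduleForm

/-! ## Modules over a finite product of division algebras -/

section ProductModules

variable {k : Type u} [Field k] {ι : Type} [Fintype ι] [DecidableEq ι] {D : ι → Type u}
  [∀ i, DivisionRing (D i)] [∀ i, Algebra k (D i)]

theorem sum_op_single_smul {X : Type u} [AddCommGroup X] [Module (∀ i, D i)ᵐᵒᵖ X] (x : X) :
    ∑ i, op (Pi.single i 1 : ∀ i, D i) • x = x := by
  rw [← Finset.sum_smul, ← Finset.op_sum,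
    show ∑ i, (Pi.single i 1 : ∀ i, D i) = 1 from Finset.univ_sum_single 1, op_one, one_smul]

/-! ### Right modules and their multiplicities -/

section RightPart

variable (k D) (X : Type u) [AddCommGroup X] [Module k X] [Module (∀ i, D i)ᵐᵒᵖ X]
  [IsScalarTower k (∀ i, D i)ᵐᵒᵖ X]

/-- The subspace `X eᵢ` of a right module. -/
def rightPart (i : ι) : Submodule k X where
  carrier := {x | op (Pi.single i 1 : ∀ i, D i) • x = x}
  add_mem' := fun {x y} hx hy => by
    change _ • _ = _ at hx hy
    change _ • _ = _
    rw [smul_add, hx, hy]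
  zero_mem' := smul_zero _
  smul_mem' := fun c x hx => by
    change _ • _ = _ at hx
    change _ • _ = _
    rw [smul_comm, hx]

variable {k D X}

theorem mem_rightPart {i : ι} {x : X} :
    x ∈ rightPart k D X i ↔ op (Pi.single i 1 : ∀ i, D i) • x = x := Iff.rfl

theorem op_single_smul_mem_rightPart (i : ι) (a : D i) (x : X) :
    op (Pi.single i a : ∀ i, D i) • x ∈ rightPart k D X i := by
  rw [mem_rightPart, ← mul_smul, ← op_mul, ← Pi.single_mul, mul_one]

instance (i : ι) : Module (D i)ᵐᵒᵖ (rightPart k D X i) where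
  smul a x := ⟨op (Pi.single i (unop a) : ∀ i, D i) • x.1, op_single_smul_mem_rightPart _ _ _⟩
  one_smul x := Subtype.ext x.2
  mul_smul a b x := Subtype.ext (by
    change op (Pi.single i (unop b * unop a) : ∀ i, D i) • x.1
      = op (Pi.single i (unop a) : ∀ i, D i) • op (Pi.single i (unop b) : ∀ i, D i) • x.1
    rw [Pi.single_mul, op_mul, mul_smul])
  smul_zero a := Subtype.ext (smul_zero _)
  smul_add a x y := Subtype.ext (smul_add _ _ _)
  add_smul a b x := Subtype.ext (by
    change op (Pi.single i (unop a + unop b) : ∀ i, D i) • x.1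
      = op (Pi.single i (unop a) : ∀ i, D i) • x.1 + op (Pi.single i (unop b) : ∀ i, D i) • x.1
    rw [Pi.single_add, MulOpposite.op_add, add_smul])
  zero_smul x := Subtype.ext (by
    change op (Pi.single i 0 : ∀ i, D i) • x.1 = 0
    rw [Pi.single_zero, MulOpposite.op_zero, zero_smul])

theorem rightPart_smul_coe (i : ι) (a : D i) (x : rightPart k D X i) :
    ((op a • x : rightPart k D X i) : X) = op (Pi.single i a : ∀ i, D i) • x.1 := rfl

theorem op_smul_rightPart (i : ι) (a : ∀ i, D i) (x : rightPart k D X i) :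
    op a • x.1 = ((op (a i) • x : rightPart k D X i) : X) := by
  rw [rightPart_smul_coe]
  conv_lhs => rw [← mem_rightPart.1 x.2, ← mul_smul, ← op_mul]
  congr 2
  ext j
  by_cases h : j = i
  · subst h; simp
  · simp [h]

instance (i : ι) : IsScalarTower k (D i)ᵐᵒᵖ (rightPart k D X i) :=
  ⟨fun c a x => Subtype.ext (by
    change op (Pi.single i (c • unop a) : ∀ i, D i) • x.1
      = c • op (Pi.single i (unop a) : ∀ i, D i) • x.1
    rw [Pi.single_smul, op_smul, smul_assoc])⟩

variable (k D X) in
/-- The multiplicity `dim X eᵢ / dim Aᵢ` of the simple module `eᵢ A` in `X`. -/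
noncomputable def rightMultiplicity (i : ι) : ℕ := Module.finrank (D i)ᵐᵒᵖ (rightPart k D X i)

variable [∀ i, FiniteDimensional k (D i)] [FiniteDimensional k X]

instance (i : ι) : Module.Finite (D i)ᵐᵒᵖ (rightPart k D X i) :=
  Module.Finite.of_restrictScalars_finite k (D i)ᵐᵒᵖ (rightPart k D X i)

variable (k D X) in
/-- A basis of `X eᵢ` over `Aᵢ`. -/
noncomputable def rightPartBasis (i : ι) :
    Module.Basis (Fin (rightMultiplicity k D X i)) (D i)ᵐᵒᵖ (rightPart k D X i) :=
  Module.finBasis (D i)ᵐᵒᵖ (rightPart k D X i)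

theorem finrank_rightPart (i : ι) :
    Module.finrank k (rightPart k D X i) = Module.finrank k (D i) * rightMultiplicity k D X i := by
  rw [(opLinearEquiv k : D i ≃ₗ[k] (D i)ᵐᵒᵖ).finrank_eq]
  exact (Module.finrank_mul_finrank k (D i)ᵐᵒᵖ (rightPart k D X i)).symm

theorem finrank_le_sum_rightPart :
    Module.finrank k X ≤ ∑ i, Module.finrank k (rightPart k D X i) := by
  rw [← Module.finrank_pi_fintype]
  refine LinearMap.finrank_le_finrank_of_injective
    (f := LinearMap.pi fun i => LinearMap.codRestrict (rightPart k D X i)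
      (DistribSMul.toLinearMap k X (op (Pi.single i 1 : ∀ i, D i)))
      (fun x => op_single_smul_mem_rightPart i 1 x)) ?_
  rw [injective_iff_map_eq_zero]
  intro x hx
  rw [← sum_op_single_smul (D := D) x]
  exact Finset.sum_eq_zero fun i _ => congrArg Subtype.val (congrFun hx i)

/-- The endomorphism of `X` with prescribed values on bases of the `X eᵢ`. -/
noncomputable def endOfBasis :
    (∀ i, Fin (rightMultiplicity k D X i) → rightPart k D X i) →ₗ[k] (X →ₗ[(∀ i, D i)ᵐᵒᵖ] X) where
  toFun c :=
    { toFun := fun x => ∑ i, ((rightPartBasis k D X i).constr k (c i)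
        ⟨op (Pi.single i 1 : ∀ i, D i) • x, op_single_smul_mem_rightPart i 1 x⟩ : X)
      map_add' := fun x y => by
        rw [← Finset.sum_add_distrib]
        refine Finset.sum_congr rfl fun i _ => ?_
        rw [← Submodule.coe_add, ← map_add]
        congr 2
        exact Subtype.ext (smul_add _ _ _)
      map_smul' := fun a x => by
        obtain ⟨a, rfl⟩ := op_surjective a
        rw [RingHom.id_apply, Finset.smul_sum]
        refine Finset.sum_congr rfl fun i _ => ?_
        rw [op_smul_rightPart, ← map_smul]
        congr 2
        refine Subtype.ext ?_
        change op (Pi.single i 1 : ∀ i, D i) • op a • x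
          = op (Pi.single i (a i) : ∀ i, D i) • op (Pi.single i 1 : ∀ i, D i) • x
        rw [← mul_smul, ← mul_smul, ← op_mul, ← op_mul]
        congr 2
        ext j
        by_cases h : j = i
        · subst h; simp
        · simp [h] }
  map_add' c c' := by
    ext x
    simp [Finset.sum_add_distrib]
  map_smul' r c := by
    ext x
    simp [Finset.smul_sum]

theorem endOfBasis_injective :
    Function.Injective (endOfBasis (k := k) (D := D) (X := X)) := by
  rw [injective_iff_map_eq_zero]
  intro c hc
  ext i l
  have h1 := LinearMap.congr_fun hc (rightPartBasis k D X i l : X)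
  change ∑ j, ((rightPartBasis k D X j).constr k (c j)
        ⟨op (Pi.single j 1 : ∀ i, D i) • (rightPartBasis k D X i l : X),
          op_single_smul_mem_rightPart j 1 _⟩ : X) = 0 at h1
  rw [Finset.sum_eq_single i] at h1
  · have h2 : (⟨op (Pi.single i 1 : ∀ i, D i) • (rightPartBasis k D X i l : X),
        op_single_smul_mem_rightPart i 1 _⟩ : rightPart k D X i) = rightPartBasis k D X i l :=
      Subtype.ext (mem_rightPart.1 (rightPartBasis k D X i l).2)
    rw [h2, Module.Basis.constr_basis] at h1
    exact h1
  · intro j _ hj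
    have h2 : (⟨op (Pi.single j 1 : ∀ i, D i) • (rightPartBasis k D X i l : X),
        op_single_smul_mem_rightPart j 1 _⟩ : rightPart k D X j) = 0 := by
      refine Subtype.ext ?_
      change op (Pi.single j 1 : ∀ i, D i) • (rightPartBasis k D X i l : X) = 0
      rw [op_smul_rightPart, Pi.single_eq_of_ne hj.symm, MulOpposite.op_zero, zero_smul]
      rfl
    rw [h2, map_zero]
    rfl
  · simp

/-- A lower bound suffices for the Euler form estimate, so it is enough that images of the basis
vectors of each `X eᵢ` can be chosen freely in `X eᵢ`, with different choices giving different
endomorphisms. -/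
theorem sum_multiplicity_mul_finrank_le
    [FiniteDimensional k (X →ₗ[(∀ i, D i)ᵐᵒᵖ] X)] :
    ∑ i, rightMultiplicity k D X i * Module.finrank k (rightPart k D X i)
      ≤ Module.finrank k (X →ₗ[(∀ i, D i)ᵐᵒᵖ] X) := by
  refine le_trans (le_of_eq ?_) (LinearMap.finrank_le_finrank_of_injective
    (endOfBasis_injective (k := k) (D := D) (X := X)))
  rw [Module.finrank_pi_fintype]
  refine Finset.sum_congr rfl fun i _ => ?_
  rw [Module.finrank_pi_fintype]
  simp

end RightPart

/-! ### Homomorphisms from `X ⊗ N` to `X` -/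

section Bimodule

variable {N : Type u} [AddCommGroup N] [Module k N] [Module (∀ i, D i) N]
  [Module (∀ i, D i)ᵐᵒᵖ N] [SMulCommClass (∀ i, D i) (∀ i, D i)ᵐᵒᵖ N]
  [IsScalarTower k (∀ i, D i) N] [IsScalarTower k (∀ i, D i)ᵐᵒᵖ N]

variable (D N) in
/-- The right module `eᵢ N`. -/
def leftPart (i : ι) : Submodule (∀ i, D i)ᵐᵒᵖ N where
  carrier := {x | (Pi.single i 1 : ∀ i, D i) • x = x}
  add_mem' := fun {x y} hx hy => by
    change _ • _ = _ at hx hy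
    change _ • _ = _
    rw [smul_add, hx, hy]
  zero_mem' := smul_zero _
  smul_mem' := fun c x hx => by
    change _ • _ = _ at hx
    change _ • _ = _
    rw [smul_comm, hx]

theorem single_smul_mem_leftPart (i : ι) (a : D i) (x : N) :
    (Pi.single i a : ∀ i, D i) • x ∈ leftPart D N i := by
  change (Pi.single i 1 : ∀ i, D i) • (Pi.single i a : ∀ i, D i) • x = _
  rw [← mul_smul, ← Pi.single_mul, one_mul]

instance (i : ι) [FiniteDimensional k N] : FiniteDimensional k (leftPart D N i) :=
  FiniteDimensional.of_injective ((leftPart D N i).subtype.restrictScalars k)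
    Subtype.val_injective

theorem mem_idempotentPart {i j : ι} {x : N} : x ∈ idempotentPart k D N i j ↔
    (Pi.single i 1 : ∀ i, D i) • x = x ∧ op (Pi.single j 1 : ∀ i, D i) • x = x := by
  constructor
  · rintro ⟨y, rfl⟩
    change (Pi.single i 1 : ∀ i, D i) • (Pi.single i 1 : ∀ i, D i) •
        op (Pi.single j 1 : ∀ i, D i) • y
          = (Pi.single i 1 : ∀ i, D i) • op (Pi.single j 1 : ∀ i, D i) • y ∧
      op (Pi.single j 1 : ∀ i, D i) • (Pi.single i 1 : ∀ i, D i) •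
        op (Pi.single j 1 : ∀ i, D i) • y
          = (Pi.single i 1 : ∀ i, D i) • op (Pi.single j 1 : ∀ i, D i) • y
    constructor
    · rw [← mul_smul, ← Pi.single_mul, one_mul]
    · rw [← smul_comm, ← mul_smul, ← op_mul, ← Pi.single_mul, one_mul]
  · rintro ⟨h1, h2⟩
    refine ⟨x, ?_⟩
    change (Pi.single i 1 : ∀ i, D i) • op (Pi.single j 1 : ∀ i, D i) • x = x
    rw [h2, h1]

theorem finrank_rightPart_leftPart_le [FiniteDimensional k N] (i j : ι) :
    Module.finrank k (rightPart k D (leftPart D N i) j)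
      ≤ Module.finrank k (idempotentPart k D N i j) := by
  refine LinearMap.finrank_le_finrank_of_injective
    (f := LinearMap.codRestrict (idempotentPart k D N i j)
      (((leftPart D N i).subtype.restrictScalars k).comp
        (rightPart k D (leftPart D N i) j).subtype)
      (fun x => mem_idempotentPart.2 ⟨x.1.2, congrArg Subtype.val x.2⟩)) ?_
  intro x y h
  have h' : ((x : leftPart D N i) : N) = ((y : leftPart D N i) : N) :=
    congrArg (fun z : idempotentPart k D N i j => (z : N)) h
  exact Subtype.ext (Subtype.ext h')

variable {X : Type u} [AddCommGroup X] [Module k X] [Module (∀ i, D i)ᵐᵒᵖ X]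
  [IsScalarTower k (∀ i, D i)ᵐᵒᵖ X] [∀ i, FiniteDimensional k (D i)] [FiniteDimensional k X]
  [FiniteDimensional k N]

open BimoduleForm in
/-- The values of an action on bases. -/
noncomputable def actionValues : actions (∀ i, D i) N k X →ₗ[k]
    (∀ i, Fin (rightMultiplicity k D X i) →
      ∀ j, Fin (rightMultiplicity k D (leftPart D N i) j) → rightPart k D X j) where
  toFun ψ i l j m := ⟨ψ.1 (rightPartBasis k D X i l : X)
      ((rightPartBasis k D (leftPart D N i) j m : leftPart D N i) : N), by
    rw [mem_rightPart, ← ψ.2.2]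
    congr 1
    exact congrArg Subtype.val (mem_rightPart.1 (rightPartBasis k D (leftPart D N i) j m).2)⟩
  map_add' ψ ψ' := rfl
  map_smul' c ψ := rfl

open BimoduleForm in
-- Coefficients of the `n` in `eᵢ N eⱼ` come out on the right by right linearity. A coefficient of a
-- basis vector of `X eᵢ` crosses the tensor sign and turns `n` into an element of `eᵢ N`. So the
-- values on pairs of basis vectors determine the action.
theorem actionValues_injective :
    Function.Injective (actionValues (k := k) (D := D) (X := X) (N := N)) := by
  rw [injective_iff_map_eq_zero]
  intro ψ hψ
  have h1 : ∀ i l j m, ψ.1 (rightPartBasis k D X i l : X)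
      ((rightPartBasis k D (leftPart D N i) j m : leftPart D N i) : N) = 0 := fun i l j m =>
    congrArg Subtype.val (congrFun (congrFun (congrFun (congrFun hψ i) l) j) m)
  have h2 : ∀ i l j (n : rightPart k D (leftPart D N i) j),
      ψ.1 (rightPartBasis k D X i l : X) (n.1 : N) = 0 := by
    intro i l j n
    rw [← (rightPartBasis k D (leftPart D N i) j).sum_repr n]
    simp only [Submodule.coe_sum, map_sum]
    refine Finset.sum_eq_zero fun m _ => ?_
    have e : ((((rightPartBasis k D (leftPart D N i) j).repr n m
          • rightPartBasis k D (leftPart D N i) j m :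
            rightPart k D (leftPart D N i) j) : leftPart D N i) : N)
        = op (Pi.single j (unop ((rightPartBasis k D (leftPart D N i) j).repr n m)) : ∀ i, D i)
          • (((rightPartBasis k D (leftPart D N i) j m) : leftPart D N i) : N) := rfl
    rw [e, ψ.2.2, h1, smul_zero]
  have h3 : ∀ i l (n : leftPart D N i), ψ.1 (rightPartBasis k D X i l : X) (n : N) = 0 := by
    intro i l n
    rw [← sum_op_single_smul (D := D) n]
    simp only [Submodule.coe_sum, map_sum]
    exact Finset.sum_eq_zero fun j _ => h2 i l j ⟨_, op_single_smul_mem_rightPart j 1 n⟩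
  have h4 : ∀ i (x : rightPart k D X i) (n : N), ψ.1 (x : X) n = 0 := by
    intro i x n
    rw [← (rightPartBasis k D X i).sum_repr x]
    simp only [Submodule.coe_sum, map_sum, LinearMap.sum_apply]
    refine Finset.sum_eq_zero fun l _ => ?_
    have e : (((rightPartBasis k D X i).repr x l • rightPartBasis k D X i l :
          rightPart k D X i) : X)
        = op (Pi.single i (unop ((rightPartBasis k D X i).repr x l)) : ∀ i, D i)
          • (rightPartBasis k D X i l : X) := rfl
    rw [e, ψ.2.1]
    exact h3 i l ⟨_, single_smul_mem_leftPart i _ n⟩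
  ext x n
  conv_lhs => rw [← sum_op_single_smul (D := D) x]
  simp only [map_sum, LinearMap.sum_apply]
  exact Finset.sum_eq_zero fun i _ => h4 i ⟨_, op_single_smul_mem_rightPart i 1 x⟩ n

open BimoduleForm in
theorem finrank_actions_le :
    Module.finrank k (actions (∀ i, D i) N k X)
      ≤ ∑ i, rightMultiplicity k D X i * ∑ j, rightMultiplicity k D (leftPart D N i) j
        * Module.finrank k (rightPart k D X j) := by
  refine (LinearMap.finrank_le_finrank_of_injective
    (actionValues_injective (k := k) (D := D) (X := X) (N := N))).trans (le_of_eq ?_)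
  simp only [Module.finrank_pi_fintype, Finset.sum_const, Finset.card_univ, Fintype.card_fin,
    smul_eq_mul]

end Bimodule

end ProductModules

/-! ## The bimodule `M ⊕ DM` -/

section Double

variable {k A M : Type u} [Field k] [Ring A] [Algebra k A]
  [AddCommGroup M] [Module k M] [Module A M] [Module Aᵐᵒᵖ M] [SMulCommClass A Aᵐᵒᵖ M]
  [IsScalarTower k A M] [IsScalarTower k Aᵐᵒᵖ M]

namespace KDual

theorem ksmul_apply (c : k) (ξ : KDual k M) (m : M) : (c • ξ) m = c * ξ m := rfl

theorem map_add' (ξ : KDual k M) (m m' : M) : ξ (m + m') = ξ m + ξ m' := ξ.toLinearMap.map_add m m'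

theorem map_ksmul (ξ : KDual k M) (c : k) (m : M) : ξ (c • m) = c * ξ m :=
  ξ.toLinearMap.map_smul c m

theorem map_zero' (ξ : KDual k M) : ξ 0 = 0 := ξ.toLinearMap.map_zero

theorem neg_apply (ξ : KDual k M) (m : M) : (-ξ) m = -ξ m := rfl

theorem sum_apply {α : Type*} (s : Finset α) (ξ : α → KDual k M) (m : M) :
    (∑ i ∈ s, ξ i) m = ∑ i ∈ s, ξ i m := LinearMap.sum_apply _ _ _

theorem map_sum' (ξ : KDual k M) {α : Type*} (s : Finset α) (x : α → M) :
    ξ (∑ i ∈ s, x i) = ∑ i ∈ s, ξ (x i) := map_sum ξ.toLinearMap _ _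

instance : IsScalarTower k A (KDual k M) :=
  ⟨fun c a ξ => KDual.ext fun m => by
    rw [smul_apply, ksmul_apply, smul_apply, op_smul, smul_assoc, map_ksmul]⟩

instance : IsScalarTower k Aᵐᵒᵖ (KDual k M) :=
  ⟨fun c a ξ => KDual.ext fun m => by
    obtain ⟨a, rfl⟩ := op_surjective a
    rw [← op_smul, op_smul_apply, ksmul_apply, op_smul_apply, smul_assoc, map_ksmul]⟩

instance [FiniteDimensional k M] : FiniteDimensional k (KDual k M) :=
  inferInstanceAs (FiniteDimensional k (Module.Dual k M))

theorem finrank_eq : Module.finrank k (KDual k M) = Module.finrank k M :=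
  Subspace.dual_finrank_eq

end KDual

/-! ### Replacing `k`-valued functionals by elements of `A` -/

namespace SymmetrisingForm

variable (σ : SymmetrisingForm k A) [FiniteDimensional k A]

/-- The isomorphism `A ≅ DA` given by a symmetrising form. -/
noncomputable def dualEquiv : A ≃ₗ[k] (A →ₗ[k] k) :=
  LinearEquiv.ofInjectiveOfFinrankEq
    ((LinearMap.mul k A).compr₂ σ.toLinearMap)
    ((injective_iff_map_eq_zero _).2 fun a ha =>
      σ.nondegenerate a fun b => LinearMap.congr_fun ha b)
    Subspace.dual_finrank_eq.symm

/-- The element `a` of `A` with `σ(b a) = λ(b)` for all `b`. -/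
noncomputable def rep : (A →ₗ[k] k) →ₗ[k] A := σ.dualEquiv.symm

theorem apply_mul_rep (l : A →ₗ[k] k) (b : A) : σ.toLinearMap (b * σ.rep l) = l b := by
  rw [σ.symm]
  exact LinearMap.congr_fun (σ.dualEquiv.apply_symm_apply l) b

theorem eq_of_apply_mul {a a' : A} (h : ∀ b, σ.toLinearMap (b * a) = σ.toLinearMap (b * a')) :
    a = a' := by
  rw [← sub_eq_zero]
  refine σ.nondegenerate _ fun b => ?_
  rw [σ.symm, mul_sub, map_sub, h, sub_self]

theorem rep_eq {l : A →ₗ[k] k} {a : A} (h : ∀ b, l b = σ.toLinearMap (b * a)) : σ.rep l = a :=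
  σ.eq_of_apply_mul fun b => by rw [apply_mul_rep, h]

end SymmetrisingForm

/-! ### The self-duality of `M ⊕ DM` -/

section Pairing

variable (k M) in
/-- The alternating form `⟨(m, ξ), (m', ξ')⟩ = ξ(m') - ξ'(m)` on `M ⊕ DM`. -/
def doublePairing (n n' : M × KDual k M) : k := n.2 n'.1 - n'.2 n.1

theorem doublePairing_alt (n n' : M × KDual k M) :
    doublePairing k M n n' = -doublePairing k M n' n := (neg_sub _ _).symm

theorem doublePairing_add_left (n n' n'' : M × KDual k M) :
    doublePairing k M (n + n') n'' = doublePairing k M n n'' + doublePairing k M n' n'' := by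
  simp only [doublePairing, Prod.fst_add, Prod.snd_add, KDual.add_apply, KDual.map_add']
  ring

theorem doublePairing_add_right (n n' n'' : M × KDual k M) :
    doublePairing k M n (n' + n'') = doublePairing k M n n' + doublePairing k M n n'' := by
  simp only [doublePairing, Prod.fst_add, Prod.snd_add, KDual.add_apply, KDual.map_add']
  ring

theorem doublePairing_ksmul_left (c : k) (n n' : M × KDual k M) :
    doublePairing k M (c • n) n' = c * doublePairing k M n n' := by
  simp only [doublePairing, Prod.smul_fst, Prod.smul_snd, KDual.ksmul_apply, KDual.map_ksmul]
  ring

theorem doublePairing_smul_left (a : A) (n n' : M × KDual k M) :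
    doublePairing k M (a • n) n' = doublePairing k M n (op a • n') := rfl

theorem doublePairing_op_smul_left (a : A) (n n' : M × KDual k M) :
    doublePairing k M (op a • n) n' = doublePairing k M n (a • n') := rfl

variable (σ : SymmetrisingForm k A) [FiniteDimensional k A]

/-- The `A`-valued form on `M ⊕ DM` corresponding to the alternating form. -/
noncomputable def doubleForm (n n' : M × KDual k M) : A :=
  σ.rep
    { toFun := fun b => doublePairing k M (b • n) n'
      map_add' := fun b c => by rw [add_smul, doublePairing_add_left]
      map_smul' := fun c b => by
        rw [smul_assoc, doublePairing_ksmul_left]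
        rfl }

theorem apply_mul_doubleForm (n n' : M × KDual k M) (b : A) :
    σ.toLinearMap (b * doubleForm σ n n') = doublePairing k M (b • n) n' :=
  σ.apply_mul_rep _ b

theorem doubleForm_eq {n n' : M × KDual k M} {a : A}
    (h : ∀ b : A, doublePairing k M (b • n) n' = σ.toLinearMap (b * a)) : doubleForm σ n n' = a :=
  σ.rep_eq h

variable (d : IdentityRepresentatives A M)

/-- The form on `M ⊕ DM` with its canonical element `ρ - ℓ`. -/
noncomputable def doubleBimoduleForm : BimoduleForm A (M × KDual k M) where
  form := AddMonoidHom.mk' (fun n => AddMonoidHom.mk' (fun n' => doubleForm σ n n')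
      (fun n' n'' => doubleForm_eq σ fun b => by
        rw [mul_add, map_add, apply_mul_doubleForm, apply_mul_doubleForm, doublePairing_add_right]))
    (fun n n' => AddMonoidHom.ext fun n'' => doubleForm_eq σ fun b => by
      change _ = σ.toLinearMap (b * (doubleForm σ n n'' + doubleForm σ n' n''))
      rw [mul_add, map_add, apply_mul_doubleForm, apply_mul_doubleForm, smul_add,
        doublePairing_add_left])
  smul_left a n n' := doubleForm_eq σ fun b => by
    change _ = σ.toLinearMap (b * (a * doubleForm σ n n'))
    rw [← mul_assoc, apply_mul_doubleForm, mul_smul]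
  smul_right a n n' := doubleForm_eq σ fun b => by
    change _ = σ.toLinearMap (b * (doubleForm σ n n' * a))
    rw [← mul_assoc, σ.symm, ← mul_assoc, apply_mul_doubleForm, mul_smul,
      doublePairing_smul_left a]
  balanced a n n' := doubleForm_eq σ fun b => by
    change _ = σ.toLinearMap (b * doubleForm σ n (a • n'))
    rw [apply_mul_doubleForm, smul_comm, doublePairing_op_smul_left]
  idx := Fin d.r ⊕ Fin d.s
  fintype := inferInstance
  -- The sign of `ℓ` is carried by `-ν j`; it is forced by the pairing being alternating.
  u := Sum.elim (fun i => (d.m i, 0)) (fun j => (0, -d.nu σ j))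
  v := Sum.elim (fun i => (0, d.mu σ i)) (fun j => (d.n j, 0))
  sum_u := by
    rintro ⟨x, ξ⟩
    rw [Fintype.sum_sum_type]
    change ∑ i, op (doubleForm σ (0, d.mu σ i) (x, ξ)) • ((d.m i, 0) : M × KDual k M)
      + ∑ j, op (doubleForm σ (d.n j, 0) (x, ξ)) • ((0, -d.nu σ j) : M × KDual k M) = (x, ξ)
    have h1 : ∀ i, doubleForm σ (0, d.mu σ i) (x, ξ) = d.f i x := fun i =>
      doubleForm_eq σ fun b => by
        simp only [doublePairing, Prod.smul_mk, smul_zero, KDual.map_zero', sub_zero,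
          KDual.smul_apply, IdentityRepresentatives.mu_apply, map_smul,
          MulOpposite.smul_eq_mul_unop, unop_op]
        exact σ.symm _ _
    -- The pairing of `(n j, 0)` with `(x, ξ)` is `-ξ(n j)`, and the two signs cancel; the equality
    -- is tested on `y = ∑ g j (y) n j`.
    have h2 : ∑ j, op (doubleForm σ (d.n j, 0) (x, ξ)) • (-d.nu σ j) = ξ := by
      refine KDual.ext fun y => ?_
      rw [KDual.sum_apply]
      conv_rhs => rw [← d.sum_left y, KDual.map_sum']
      refine Finset.sum_congr rfl fun j _ => ?_
      rw [KDual.op_smul_apply, KDual.neg_apply, IdentityRepresentatives.nu_apply, map_smul,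
        smul_eq_mul, σ.symm, apply_mul_doubleForm]
      change -((0 : k) - ξ (d.g j y • d.n j)) = _
      ring
    simp only [h1, Prod.smul_mk, smul_zero]
    refine Prod.ext ?_ ?_ <;>
      simp only [Prod.fst_add, Prod.snd_add, Prod.fst_sum, Prod.snd_sum, Finset.sum_const_zero,
        d.sum_right, h2, add_zero, zero_add]
  sum_v := by
    rintro ⟨x, ξ⟩
    rw [Fintype.sum_sum_type]
    change ∑ i, doubleForm σ (x, ξ) (d.m i, 0) • ((0, d.mu σ i) : M × KDual k M)
      + ∑ j, doubleForm σ (x, ξ) (0, -d.nu σ j) • ((d.n j, 0) : M × KDual k M) = (x, ξ)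
    have h1 : ∀ j, doubleForm σ (x, ξ) (0, -d.nu σ j) = d.g j x := fun j =>
      doubleForm_eq σ fun b => by
        simp only [doublePairing, Prod.smul_mk, KDual.map_zero', KDual.neg_apply, sub_neg_eq_add,
          zero_add, IdentityRepresentatives.nu_apply, map_smul, smul_eq_mul]
    have h2 : ∑ i, doubleForm σ (x, ξ) (d.m i, 0) • d.mu σ i = ξ := by
      refine KDual.ext fun y => ?_
      rw [KDual.sum_apply]
      conv_rhs => rw [← d.sum_right y, KDual.map_sum']
      refine Finset.sum_congr rfl fun j _ => ?_
      rw [KDual.smul_apply, IdentityRepresentatives.mu_apply, map_smul,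
        MulOpposite.smul_eq_mul_unop, unop_op, apply_mul_doubleForm]
      exact sub_zero _
    simp only [h1, Prod.smul_mk, smul_zero]
    refine Prod.ext ?_ ?_ <;>
      simp only [Prod.fst_add, Prod.snd_add, Prod.fst_sum, Prod.snd_sum, Finset.sum_const_zero,
        d.sum_left, h2, add_zero, zero_add]

theorem doubleBimoduleForm_form (n n' : M × KDual k M) :
    (doubleBimoduleForm σ d).form n n' = doubleForm σ n n' := rfl

theorem sum_doubleBimoduleForm {Z : Type*} [AddCommGroup Z]
    (G : M × KDual k M → M × KDual k M → Z) (hneg : ∀ n n', G (-n) n' = -G n n') :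
    ∑ s, G ((doubleBimoduleForm σ d).u s) ((doubleBimoduleForm σ d).v s)
      = ∑ i, G (d.m i, 0) (0, d.mu σ i) - ∑ j, G (0, d.nu σ j) (d.n j, 0) := by
  refine (Fintype.sum_sum_type _).trans ?_
  rw [sub_eq_add_neg, ← Finset.sum_neg_distrib]
  congr 1
  refine Finset.sum_congr rfl fun j _ => ?_
  rw [← hneg]
  change G (0, -d.nu σ j) (d.n j, 0) = _
  rw [Prod.neg_mk, neg_zero]

end Pairing

end Double

/-! ## Bounded dimension of cyclic modules -/

section Bound

variable {k : Type u} [Field k] {ι : Type} [Fintype ι] [DecidableEq ι] {D : ι → Type u}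
  [∀ i, DivisionRing (D i)] [∀ i, Algebra k (D i)] [∀ i, FiniteDimensional k (D i)]
  {M : Type u} [AddCommGroup M] [Module k M] [FiniteDimensional k M]
  [Module (∀ i, D i) M] [Module (∀ i, D i)ᵐᵒᵖ M] [SMulCommClass (∀ i, D i) (∀ i, D i)ᵐᵒᵖ M]
  [IsScalarTower k (∀ i, D i) M] [IsScalarTower k (∀ i, D i)ᵐᵒᵖ M]

/-- The summand `eᵢ DM eⱼ` embeds in the dual of `eⱼ M eᵢ`, because `(eᵢ ξ eⱼ)(y) = ξ(eⱼ y eᵢ)`.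
This produces the symmetric matrix `R + Rᵗ`. -/
theorem finrank_idempotentPart_double_le (i j : ι) :
    Module.finrank k (idempotentPart k D (M × KDual k M) i j)
      ≤ Module.finrank k (idempotentPart k D M i j)
        + Module.finrank k (idempotentPart k D M j i) := by
  rw [← KDual.finrank_eq (M := idempotentPart k D M j i), ← Module.finrank_prod]
  refine LinearMap.finrank_le_finrank_of_injective (f :=
    ({ toFun := fun x => (⟨x.1.1, ?_⟩, x.1.2.toLinearMap.comp (Submodule.subtype _))
       map_add' := fun x y => rfl
       map_smul' := fun c x => rfl } : idempotentPart k D (M × KDual k M) i j →ₗ[k]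
        idempotentPart k D M i j × KDual k (idempotentPart k D M j i))) ?_
  · have h := mem_idempotentPart.1 x.2
    exact mem_idempotentPart.2 ⟨congrArg Prod.fst h.1, congrArg Prod.fst h.2⟩
  · rw [injective_iff_map_eq_zero]
    rintro ⟨⟨m, ξ⟩, hx⟩ h0
    have h1 : m = 0 := congrArg (fun z => (z.1 : M)) h0
    have h := mem_idempotentPart.1 hx
    have h2 : (Pi.single i 1 : ∀ i, D i) • ξ = ξ := congrArg Prod.snd h.1
    have h3 : op (Pi.single j 1 : ∀ i, D i) • ξ = ξ := congrArg Prod.snd h.2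
    have h4 : ξ = 0 := by
      refine KDual.ext fun y => ?_
      rw [← h2, KDual.smul_apply, ← h3, KDual.op_smul_apply]
      exact congrArg (fun z : idempotentPart k D M i j × KDual k (idempotentPart k D M j i) =>
        z.2 ⟨_, y, rfl⟩) h0
    subst h1 h4
    rfl

/-- For a tensor algebra of Dynkin type, the dimension of cyclic modules `X` over the tensor
algebra of `M ⊕ DM` with `X (ρ - ℓ) = 0` is bounded. -/
theorem exists_finrank_cyclic_le (hDynkin : IsDynkinCartan (cartanMatrix k D M))
    (σ : SymmetrisingForm k (∀ i, D i)) (d : IdentityRepresentatives (∀ i, D i) M) :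
    ∃ K : ℕ, ∀ (X : Type u) [AddCommGroup X] [Module k X] [Module (∀ i, D i)ᵐᵒᵖ X]
      [IsScalarTower k (∀ i, D i)ᵐᵒᵖ X] [FiniteDimensional k X]
      (act : BimoduleForm.actions (∀ i, D i) (M × KDual k M) k X) (x₀ : X),
      (∀ x, ∑ s, act.1 (act.1 x ((doubleBimoduleForm σ d).u s))
        ((doubleBimoduleForm σ d).v s) = 0) →
      (∀ S : Submodule (∀ i, D i)ᵐᵒᵖ X, x₀ ∈ S → (∀ x ∈ S, ∀ n, act.1 x n ∈ S) → S = ⊤) →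
      Module.finrank k X ≤ K := by
  obtain ⟨z, hz, hCz⟩ := hDynkin.exists_pos
  set δ : ι → ℚ := fun i => Module.finrank k (D i) with hδ
  have hδpos : ∀ i, 0 < δ i := fun i => by
    simp only [hδ]
    exact_mod_cast Module.finrank_pos
  set r : ι → ι → ℚ := fun i j => Module.finrank k (idempotentPart k D M i j) with hr
  have hr0 : ∀ i j, 0 ≤ r i j := fun i j => by positivity
  -- Multiplying row `i` by `dim Aᵢ` symmetrises the Cartan matrix.
  set B : ι → ι → ℚ := fun i j => δ i * cartanMatrix k D M i j with hB
  have hB' : ∀ i j, B i j = (if i = j then 2 * δ i else 0) - (r i j + r j i) := by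
    intro i j
    have h := (hδpos i).ne'
    have e : cartanMatrix k D M i j = (if i = j then 2 else 0) - (r i j + r j i) / δ i := rfl
    simp only [hB, e]
    rw [mul_sub, mul_div_cancel₀ _ h]
    split_ifs <;> ring
  obtain ⟨K, hK⟩ := Matrix.exists_bound_of_form_le B
    (fun i j => by
      rw [hB', hB']
      by_cases h : i = j
      · subst h; ring
      · rw [if_neg h, if_neg (Ne.symm h)]; ring)
    (fun i j h => by
      rw [hB', if_neg h]
      linarith [hr0 i j, hr0 j i]) z hz
    (fun i => by
      simp only [hB, mul_assoc, ← Finset.mul_sum]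
      exact mul_pos (hδpos i) (hCz i)) (fun i => 2 * δ i)
  refine ⟨⌈K⌉₊, fun X _ _ _ _ _ act x₀ hrel hgen => ?_⟩
  have h1 := (doubleBimoduleForm σ d).two_mul_finrank_end_le act σ hrel x₀ hgen
  have hfin : FiniteDimensional k (X →ₗ[(∀ i, D i)ᵐᵒᵖ] X) :=
    FiniteDimensional.of_injective
      ({ toFun := fun φ => φ.restrictScalars k, map_add' := fun _ _ => rfl,
         map_smul' := fun _ _ => rfl } : (X →ₗ[(∀ i, D i)ᵐᵒᵖ] X) →ₗ[k] (X →ₗ[k] X))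
      (fun φ φ' h => LinearMap.ext fun x => LinearMap.congr_fun h x)
  have h2 := sum_multiplicity_mul_finrank_le (k := k) (D := D) (X := X)
  have h3 := finrank_actions_le (k := k) (D := D) (X := X) (N := M × KDual k M)
  have h4 := finrank_le_sum_rightPart (k := k) (D := D) (X := X)
  set u : ι → ℚ := fun i => rightMultiplicity k D X i with hu
  have hu0 : ∀ i, 0 ≤ u i := fun i => by positivity
  have hx : ∀ i, (Module.finrank k (rightPart k D X i) : ℚ) = δ i * u i := fun i => by
    rw [finrank_rightPart]
    push_cast
    rfl
  -- The multiplicity of `eⱼ A` in `eᵢ N`, times `dim Aⱼ`, is `dim eᵢ N eⱼ`.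
  have hw : ∀ i j, (rightMultiplicity k D (leftPart D (M × KDual k M) i) j : ℚ) * δ j
      ≤ r i j + r j i := fun i j => by
    have h := (finrank_rightPart_leftPart_le (k := k) (D := D) (N := M × KDual k M) i j).trans
      (finrank_idempotentPart_double_le i j)
    rw [finrank_rightPart, mul_comm] at h
    simp only [hr, hδ]
    exact_mod_cast h
  have h2' : ∑ i, u i * (δ i * u i) ≤ Module.finrank k (X →ₗ[(∀ i, D i)ᵐᵒᵖ] X) := by
    simp only [← hx]
    simp only [hu]
    exact_mod_cast h2
  have h3' : (Module.finrank k (BimoduleForm.actions (∀ i, D i) (M × KDual k M) k X) : ℚ)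
      ≤ ∑ i, ∑ j, u i * (r i j + r j i) * u j := by
    refine le_trans (b := ∑ i, u i * ∑ j,
      (rightMultiplicity k D (leftPart D (M × KDual k M) i) j : ℚ) * (δ j * u j)) ?_ ?_
    · simp only [← hx]
      simp only [hu]
      exact_mod_cast h3
    · refine Finset.sum_le_sum fun i _ => ?_
      rw [Finset.mul_sum]
      refine Finset.sum_le_sum fun j _ => ?_
      rw [mul_assoc, ← mul_assoc _ (δ j)]
      exact mul_le_mul_of_nonneg_left (mul_le_mul_of_nonneg_right (hw i j) (hu0 j)) (hu0 i)
  have h4' : (Module.finrank k X : ℚ) ≤ ∑ i, δ i * u i := by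
    simp only [← hx]
    exact_mod_cast h4
  have h1' : 2 * (Module.finrank k (X →ₗ[(∀ i, D i)ᵐᵒᵖ] X) : ℚ)
      ≤ Module.finrank k (BimoduleForm.actions (∀ i, D i) (M × KDual k M) k X)
        + 2 * Module.finrank k X := by exact_mod_cast h1
  have hform : ∑ i, ∑ j, u i * B i j * u j
      = 2 * ∑ i, u i * (δ i * u i) - ∑ i, ∑ j, u i * (r i j + r j i) * u j := by
    simp only [hB', mul_sub, sub_mul, Finset.sum_sub_distrib]
    congr 1
    rw [Finset.mul_sum]
    refine Finset.sum_congr rfl fun i _ => ?_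
    simp only [mul_ite, mul_zero, ite_mul, zero_mul, Finset.sum_ite_eq, Finset.mem_univ, if_true]
    ring
  have hlin : ∑ i, 2 * δ i * u i = 2 * ∑ i, δ i * u i := by
    rw [Finset.mul_sum]
    exact Finset.sum_congr rfl fun i _ => by ring
  -- The Euler inequality says that the form at `u` is at most `2 ∑ δᵢ uᵢ`, which is the hypothesis
  -- of the bound for the linear form `l = 2 δ`.
  have h5 := hK u (by rw [hform, hlin]; linarith)
  rw [hlin] at h5
  have h6 : (0 : ℚ) ≤ Module.finrank k X := by positivity
  have h7 : (Module.finrank k X : ℚ) ≤ ⌈K⌉₊ := by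
    have := Nat.le_ceil K
    linarith
  exact_mod_cast h7

end Bound

/-! ## Finite-dimensionality of the preprojective algebra -/

namespace BimodTensorAlgebra

variable (k A N : Type u) [Field k] [Ring A] [Algebra k A]
  [AddCommGroup N] [Module k N] [Module A N] [Module Aᵐᵒᵖ N]

/-- The projection from the free algebra on `A × N` onto `T_A(N)`. -/
def mkHom : TensorAlgebra k (A × N) →ₐ[k] BimodTensorAlgebra k A N :=
  RingQuot.mkAlgHom k (BimodRel k A N)

variable {k A N} {R : Type u} [Ring R] [Algebra k R]

/-- The universal property of `T_A(N)`. -/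
noncomputable def liftHom (φ : A →ₐ[k] R) (ψ : N →ₗ[k] R)
    (hl : ∀ (a : A) n, ψ (a • n) = φ a * ψ n) (hr : ∀ n (a : A), ψ (op a • n) = ψ n * φ a) :
    BimodTensorAlgebra k A N →ₐ[k] R :=
  RingQuot.liftAlgHom k ⟨TensorAlgebra.lift k (φ.toLinearMap.coprod ψ), fun x y h => by
    induction h with
    | one => simp
    | mul a b => simp
    | left a n => simp [hl]
    | right n a => simp [hr]⟩

theorem liftHom_ofRing (φ : A →ₐ[k] R) (ψ : N →ₗ[k] R) (hl hr) (a : A) :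
    liftHom φ ψ hl hr (ofRing k A N a) = φ a :=
  (RingQuot.liftAlgHom_mkAlgHom_apply _ _ _ _).trans (by simp)

theorem liftHom_ofBimod (φ : A →ₐ[k] R) (ψ : N →ₗ[k] R) (hl hr) (n : N) :
    liftHom φ ψ hl hr (ofBimod k A N n) = ψ n :=
  (RingQuot.liftAlgHom_mkAlgHom_apply _ _ _ _).trans (by simp)

end BimodTensorAlgebra

namespace Preprojective

/-! ### Generators and universal property of `Π` -/

section Generation

variable {k A M : Type u} [Field k] [Ring A] [Algebra k A]
  [AddCommGroup M] [Module k M] [Module A M] [Module Aᵐᵒᵖ M] [SMulCommClass A Aᵐᵒᵖ M]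
  [IsScalarTower k A M] [IsScalarTower k Aᵐᵒᵖ M]
  (σ : SymmetrisingForm k A) (d : IdentityRepresentatives A M)

/-- The projection from the free algebra on `A × (M ⊕ DM)` onto `Π`. -/
def freeHom : TensorAlgebra k (A × (M × KDual k M)) →ₐ[k] Preprojective σ d :=
  (proj σ d).comp (BimodTensorAlgebra.mkHom k A (M × KDual k M))

theorem freeHom_surjective : Function.Surjective (freeHom σ d) := by
  intro p
  obtain ⟨q, rfl⟩ := RingQuot.mkAlgHom_surjective k _ p
  obtain ⟨t, rfl⟩ := RingQuot.mkAlgHom_surjective k _ q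
  exact ⟨t, rfl⟩

theorem freeHom_ι (a : A) (n : M × KDual k M) :
    freeHom σ d (TensorAlgebra.ι k (a, n)) = ofRing σ d a + ofBimod σ d n := by
  have e : ((a, n) : A × (M × KDual k M)) = (a, 0) + (0, n) := by simp
  rw [e, map_add, map_add]
  rfl

/-- A subset of a right `Π`-module which is closed under the generators is closed under `Π`. -/
theorem op_smul_mem_of_generators {X : Type u} [AddCommGroup X] [Module (Preprojective σ d)ᵐᵒᵖ X]
    (S : AddSubgroup X) (hA : ∀ a, ∀ x ∈ S, op (ofRing σ d a) • x ∈ S)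
    (hN : ∀ n, ∀ x ∈ S, op (ofBimod σ d n) • x ∈ S) (p : Preprojective σ d) :
    ∀ x ∈ S, op p • x ∈ S := by
  obtain ⟨t, rfl⟩ := freeHom_surjective σ d p
  induction t using TensorAlgebra.induction with
  | algebraMap r =>
    intro x hx
    have h := hA (algebraMap k A r) x hx
    rwa [AlgHom.commutes] at h ⊢
  | ι n =>
    intro x hx
    rw [freeHom_ι, MulOpposite.op_add, add_smul]
    exact S.add_mem (hA _ x hx) (hN _ x hx)
  | mul s t hs ht =>
    intro x hx
    rw [map_mul, op_mul, mul_smul]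
    exact ht _ (hs x hx)
  | add s t hs ht =>
    intro x hx
    rw [map_add, MulOpposite.op_add, add_smul]
    exact S.add_mem (hs x hx) (ht x hx)

/-- `Π` is generated by `1` under right multiplication by the generators. -/
theorem mem_of_generators (S : AddSubgroup (Preprojective σ d)) (h1 : 1 ∈ S)
    (hA : ∀ a, ∀ x ∈ S, x * ofRing σ d a ∈ S) (hN : ∀ n, ∀ x ∈ S, x * ofBimod σ d n ∈ S)
    (p : Preprojective σ d) : p ∈ S := by
  have h := op_smul_mem_of_generators σ d S hA hN p 1 h1
  rwa [op_smul_eq_mul, one_mul] at h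

section Lift

variable {R : Type u} [Ring R] [Algebra k R]

/-- The universal property of `Π`. -/
noncomputable def liftHom (φ : A →ₐ[k] R) (ψ : M × KDual k M →ₗ[k] R)
    (hl : ∀ a n, ψ (a • n) = φ a * ψ n) (hr : ∀ n a, ψ (op a • n) = ψ n * φ a)
    (hrel : ∑ i, ψ (d.m i, 0) * ψ (0, d.mu σ i) - ∑ j, ψ (0, d.nu σ j) * ψ (d.n j, 0) = 0) :
    Preprojective σ d →ₐ[k] R :=
  RingQuot.liftAlgHom k ⟨BimodTensorAlgebra.liftHom φ ψ hl hr, by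
    rintro x y ⟨rfl, rfl⟩
    simpa only [preprojectiveElement, map_sub, map_sum, map_mul, map_zero,
      BimodTensorAlgebra.liftHom_ofBimod] using hrel⟩

theorem liftHom_ofRing (φ : A →ₐ[k] R) (ψ : M × KDual k M →ₗ[k] R) (hl hr hrel) (a : A) :
    liftHom σ d φ ψ hl hr hrel (ofRing σ d a) = φ a :=
  (RingQuot.liftAlgHom_mkAlgHom_apply _ _ _ _).trans (BimodTensorAlgebra.liftHom_ofRing _ _ _ _ _)

theorem liftHom_ofBimod (φ : A →ₐ[k] R) (ψ : M × KDual k M →ₗ[k] R) (hl hr hrel)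
    (n : M × KDual k M) : liftHom σ d φ ψ hl hr hrel (ofBimod σ d n) = ψ n :=
  (RingQuot.liftAlgHom_mkAlgHom_apply _ _ _ _).trans (BimodTensorAlgebra.liftHom_ofBimod _ _ _ _ _)

end Lift

theorem rho_sub_ell_eq_zero :
    ∑ i, ofBimod σ d (d.m i, 0) * ofBimod σ d (0, d.mu σ i)
      - ∑ j, ofBimod σ d (0, d.nu σ j) * ofBimod σ d (d.n j, 0) = 0 := by
  have h : proj σ d (preprojectiveElement σ d) = proj σ d 0 :=
    RingQuot.mkAlgHom_rel k ⟨rfl, rfl⟩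
  rw [map_zero, preprojectiveElement, map_sub, map_sum, map_sum] at h
  simp only [map_mul] at h
  exact h

/-! ### The grading by path length -/

open Polynomial in
/-- The homomorphism `Π → Π[t]` describing the grading of `Π` by path length. -/
noncomputable def gradingHom : Preprojective σ d →ₐ[k] (Preprojective σ d)[X] :=
  liftHom σ d (Polynomial.CAlgHom.comp (ofRing σ d))
    (((Polynomial.monomial (R := Preprojective σ d) 1).restrictScalars k).comp (ofBimod σ d))
    (fun a n => by
      simp [ofBimod_smul, Polynomial.C_mul_monomial])
    (fun n a => by
      simp [ofBimod_op_smul, Polynomial.monomial_mul_C])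
    (by
      -- The relation is homogeneous of degree `2`, so it becomes `t²` times itself.
      simp only [LinearMap.comp_apply, LinearMap.coe_restrictScalars,
        Polynomial.monomial_mul_monomial, ← map_sum, ← map_sub, rho_sub_ell_eq_zero, map_zero])

theorem gradingHom_ofRing (a : A) :
    gradingHom σ d (ofRing σ d a) = Polynomial.monomial 0 (ofRing σ d a) :=
  liftHom_ofRing σ d _ _ _ _ _ a

theorem gradingHom_ofBimod (n : M × KDual k M) :
    gradingHom σ d (ofBimod σ d n) = Polynomial.monomial 1 (ofBimod σ d n) :=
  liftHom_ofBimod σ d _ _ _ _ _ n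

/-- The homogeneous component of degree `m` of `Π`. -/
noncomputable def component : ℕ → Submodule k (Preprojective σ d)
  | 0 => LinearMap.range (ofRing σ d).toLinearMap
  | m + 1 => component m * LinearMap.range (ofBimod σ d)

/-- Thus homogeneous elements of different degrees are separated by coefficients in `Π[t]`, which
gives independence of the components. -/
theorem gradingHom_of_mem_component {m : ℕ} {p : Preprojective σ d} (hp : p ∈ component σ d m) :
    gradingHom σ d p = Polynomial.monomial m p := by
  induction m generalizing p with
  | zero =>
    obtain ⟨a, rfl⟩ := hp
    exact gradingHom_ofRing σ d a
  | succ m ih =>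
    induction hp using Submodule.mul_induction_on' with
    | mem_mul_mem p hp n hn =>
      obtain ⟨n, rfl⟩ := hn
      rw [map_mul, ih hp, gradingHom_ofBimod, Polynomial.monomial_mul_monomial]
    | add x _ y _ hx hy => rw [map_add, hx, hy, map_add]

theorem mul_ofRing_mem_component {m : ℕ} {p : Preprojective σ d} (hp : p ∈ component σ d m)
    (a : A) : p * ofRing σ d a ∈ component σ d m := by
  cases m with
  | zero =>
    obtain ⟨b, rfl⟩ := hp
    exact ⟨b * a, map_mul (ofRing σ d) _ _⟩
  | succ m =>
    induction hp using Submodule.mul_induction_on' with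
    | mem_mul_mem p hp n hn =>
      obtain ⟨n, rfl⟩ := hn
      rw [mul_assoc, ← ofBimod_op_smul]
      exact Submodule.mul_mem_mul hp ⟨_, rfl⟩
    | add x _ y _ hx hy =>
      rw [add_mul]
      exact Submodule.add_mem _ hx hy

theorem iSup_component : ⨆ m, component σ d m = ⊤ := by
  rw [eq_top_iff]
  intro p _
  refine mem_of_generators σ d (⨆ m, component σ d m).toAddSubgroup
    (Submodule.mem_iSup_of_mem 0 ⟨1, map_one (ofRing σ d)⟩) (fun a x hx => ?_) (fun n x hx => ?_) p
  · change x ∈ ⨆ m, component σ d m at hx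
    change _ ∈ ⨆ m, component σ d m
    induction hx using Submodule.iSup_induction' with
    | mem m x hx => exact Submodule.mem_iSup_of_mem m (mul_ofRing_mem_component σ d hx a)
    | zero => rw [zero_mul]; exact Submodule.zero_mem _
    | add x y _ _ hx hy => rw [add_mul]; exact Submodule.add_mem _ hx hy
  · change x ∈ ⨆ m, component σ d m at hx
    change _ ∈ ⨆ m, component σ d m
    induction hx using Submodule.iSup_induction' with
    | mem m x hx => exact Submodule.mem_iSup_of_mem (m + 1) (Submodule.mul_mem_mul hx ⟨n, rfl⟩)
    | zero => rw [zero_mul]; exact Submodule.zero_mem _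
    | add x y _ _ hx hy => rw [add_mul]; exact Submodule.add_mem _ hx hy

theorem component_fg [FiniteDimensional k A] [FiniteDimensional k M] (m : ℕ) :
    (component σ d m).FG := by
  induction m with
  | zero =>
    exact Module.Finite.iff_fg.1
      (inferInstanceAs (Module.Finite k (LinearMap.range (ofRing σ d).toLinearMap)))
  | succ m ih => exact ih.mul (Module.Finite.iff_fg.1 inferInstance)

/-- The right ideal of the elements of degree at least `n`. -/
noncomputable def degreeGE (n : ℕ) : Submodule (Preprojective σ d)ᵐᵒᵖ (Preprojective σ d) where
  carrier := {p | ∀ m < n, (gradingHom σ d p).coeff m = 0}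
  add_mem' := fun {p q} hp hq m hm => by
    rw [map_add, Polynomial.coeff_add, hp m hm, hq m hm, add_zero]
  zero_mem' := fun m _ => by rw [map_zero, Polynomial.coeff_zero]
  smul_mem' := fun q p hp m hm => by
    obtain ⟨q, rfl⟩ := op_surjective q
    rw [op_smul_eq_mul, map_mul, Polynomial.coeff_mul]
    refine Finset.sum_eq_zero fun x hx => ?_
    have h := Finset.HasAntidiagonal.mem_antidiagonal.1 hx
    rw [hp x.1 (by omega), zero_mul]

theorem component_le_degreeGE {m n : ℕ} (h : n ≤ m) {p : Preprojective σ d}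
    (hp : p ∈ component σ d m) : p ∈ degreeGE σ d n := fun l hl => by
  rw [gradingHom_of_mem_component σ d hp, Polynomial.coeff_monomial_of_ne _ (by omega)]

/-- The components of degree below `n` span the quotient. These quotients are finite-dimensional
cyclic `Π`-modules, to which the Euler form bound applies. -/
theorem finiteDimensional_quotient_degreeGE [FiniteDimensional k A] [FiniteDimensional k M]
    (n : ℕ) : FiniteDimensional k (Preprojective σ d ⧸ degreeGE σ d n) := by
  have hfg : (⨆ m ∈ Finset.range n, component σ d m).FG :=
    Submodule.fg_biSup _ _ fun m _ => component_fg σ d m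
  have : FiniteDimensional k (⨆ m ∈ Finset.range n, component σ d m : Submodule k _) :=
    Module.Finite.iff_fg.2 hfg
  let f : (⨆ m ∈ Finset.range n, component σ d m : Submodule k _) →ₗ[k]
    (Preprojective σ d ⧸ degreeGE σ d n) :=
    ((degreeGE σ d n).mkQ.restrictScalars k).comp (Submodule.subtype _)
  refine Module.Finite.of_surjective f ?_
  have h : LinearMap.range ((degreeGE σ d n).mkQ.restrictScalars k) ≤ LinearMap.range f := by
    rw [LinearMap.range_eq_map, ← iSup_component σ d, Submodule.map_iSup, iSup_le_iff]
    intro m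
    rintro _ ⟨p, hp, rfl⟩
    rcases lt_or_ge m n with hm | hm
    · exact ⟨⟨p, Submodule.mem_iSup_of_mem m (Submodule.mem_iSup_of_mem
        (Finset.mem_range.2 hm) hp)⟩, rfl⟩
    · have e : (degreeGE σ d n).mkQ p = 0 :=
        (Submodule.Quotient.mk_eq_zero _).2 (component_le_degreeGE σ d hm hp)
      change (degreeGE σ d n).mkQ p ∈ _
      rw [e]
      exact Submodule.zero_mem _
  intro x
  obtain ⟨p, rfl⟩ := (degreeGE σ d n).mkQ_surjective x
  exact h ⟨p, rfl⟩

end Generation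

/-! ### Right `Π`-modules as `A`-modules with an action of `M ⊕ DM` -/

section Modules

variable {k A M : Type u} [Field k] [Ring A] [Algebra k A]
  [AddCommGroup M] [Module k M] [Module A M] [Module Aᵐᵒᵖ M] [SMulCommClass A Aᵐᵒᵖ M]
  [IsScalarTower k A M] [IsScalarTower k Aᵐᵒᵖ M]
  (σ : SymmetrisingForm k A) (d : IdentityRepresentatives A M)
  (X : Type u) [AddCommGroup X] [Module k X] [Module (Preprojective σ d)ᵐᵒᵖ X]
  [IsScalarTower k (Preprojective σ d)ᵐᵒᵖ X]

instance : Module k (Res σ d X) := inferInstanceAs (Module k X)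

instance : IsScalarTower k (Preprojective σ d)ᵐᵒᵖ (Res σ d X) :=
  inferInstanceAs (IsScalarTower k (Preprojective σ d)ᵐᵒᵖ X)

instance : IsScalarTower k Aᵐᵒᵖ (Res σ d X) :=
  ⟨fun c a x => by
    obtain ⟨a, rfl⟩ := op_surjective a
    rw [← op_smul, op_smul_eq, op_smul_eq, map_smul, op_smul, smul_assoc]⟩

instance [FiniteDimensional k X] : FiniteDimensional k (Res σ d X) :=
  inferInstanceAs (FiniteDimensional k X)

/-- The action of `M ⊕ DM` on a right `Π`-module. -/
def actions : BimoduleForm.actions A (M × KDual k M) k (Res σ d X) :=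
  ⟨LinearMap.mk₂ k (act σ d) (act_add_left σ d)
    (fun c x n => smul_comm _ c x) (act_add_right σ d)
    (fun c x n => by
      change op (ofBimod σ d (c • n)) • x = c • op (ofBimod σ d n) • x
      rw [map_smul, op_smul, smul_assoc]),
    act_smul_left σ d, act_smul_right σ d⟩

theorem actions_apply (x : Res σ d X) (n : M × KDual k M) :
    (actions σ d X).1 x n = op (ofBimod σ d n) • x := rfl

theorem sum_ofBimod_mul_ofBimod [FiniteDimensional k A] :
    ∑ s, ofBimod σ d ((doubleBimoduleForm σ d).u s) * ofBimod σ d ((doubleBimoduleForm σ d).v s)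
      = 0 := by
  rw [sum_doubleBimoduleForm σ d (fun n n' => ofBimod σ d n * ofBimod σ d n')
    (fun n n' => by rw [map_neg, neg_mul]), rho_sub_ell_eq_zero]

theorem sum_actions_actions [FiniteDimensional k A] (x : Res σ d X) :
    ∑ s, (actions σ d X).1 ((actions σ d X).1 x ((doubleBimoduleForm σ d).u s))
      ((doubleBimoduleForm σ d).v s) = 0 := by
  simp only [actions_apply, ← mul_smul, ← op_mul]
  rw [← Finset.sum_smul, ← Finset.op_sum, sum_ofBimod_mul_ofBimod, MulOpposite.op_zero, zero_smul]

end Modules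

/-- If the dimension of finite-dimensional cyclic modules is bounded, then `Π` is
finite-dimensional. -/
theorem finiteDimensional_of_cyclic_bound {k A M : Type u} [Field k] [Ring A] [Algebra k A]
    [AddCommGroup M] [Module k M] [Module A M] [Module Aᵐᵒᵖ M] [SMulCommClass A Aᵐᵒᵖ M]
    [IsScalarTower k A M] [IsScalarTower k Aᵐᵒᵖ M] [FiniteDimensional k A] [FiniteDimensional k M]
    (σ : SymmetrisingForm k A) (d : IdentityRepresentatives A M) (K : ℕ)
    (hK : ∀ n, Module.finrank k (Preprojective σ d ⧸ degreeGE σ d n) ≤ K) :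
    FiniteDimensional k (Preprojective σ d) := by
  -- Otherwise nonzero homogeneous elements of degrees `0, …, K` would be linearly independent in
  -- the quotient by degrees at least `K + 1`, whose dimension is at most `K`.
  obtain ⟨m, hm⟩ : ∃ m, component σ d m = ⊥ := by
    by_contra! hne
    choose g hg hg0 using fun m => Submodule.exists_mem_ne_zero_of_ne_bot (hne m)
    have hfin := finiteDimensional_quotient_degreeGE σ d (K + 1)
    have hli : LinearIndependent k (fun m : Fin (K + 1) => (degreeGE σ d (K + 1)).mkQ (g m)) := by
      rw [Fintype.linearIndependent_iff]
      intro c hc l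
      have h1 : ∑ m, c m • g m ∈ degreeGE σ d (K + 1) := by
        rw [← Submodule.Quotient.mk_eq_zero, ← hc]
        exact map_sum ((degreeGE σ d (K + 1)).mkQ.restrictScalars k) _ _
      have h2 := h1 l l.2
      have h3 : ∀ m : Fin (K + 1), (gradingHom σ d (c m • g m)).coeff l
          = if m = l then c m • g m else 0 := by
        intro m
        rw [gradingHom_of_mem_component σ d (Submodule.smul_mem _ (c m) (hg m)),
          Polynomial.coeff_monomial]
        simp only [Fin.ext_iff]
      rw [map_sum, Polynomial.finsetSum_coeff] at h2
      simp only [h3, Finset.sum_ite_eq', Finset.mem_univ, if_true] at h2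
      exact (smul_eq_zero.1 h2).resolve_right (hg0 l)
    have := hli.fintype_card_le_finrank.trans (hK (K + 1))
    rw [Fintype.card_fin] at this
    omega
  have hbot : ∀ l, m ≤ l → component σ d l = ⊥ := by
    intro l hl
    induction l, hl using Nat.le_induction with
    | base => exact hm
    | succ l _ ih =>
      change component σ d l * _ = ⊥
      rw [ih, Submodule.bot_mul]
  have htop : ⨆ l ∈ Finset.range m, component σ d l = ⊤ := by
    rw [eq_top_iff, ← iSup_component σ d, iSup_le_iff]
    intro l
    rcases lt_or_ge l m with h | h
    · exact le_biSup (component σ d) (Finset.mem_range.2 h)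
    · rw [hbot l h]
      exact bot_le
  exact ⟨htop ▸ Submodule.fg_biSup _ _ fun l _ => component_fg σ d l⟩

/-- The preprojective algebra of a tensor algebra of Dynkin type is finite-dimensional. -/
theorem finiteDimensional_of_isDynkinCartan {k : Type u} [Field k] {ι : Type} [Fintype ι]
    [DecidableEq ι] {D : ι → Type u} [∀ i, DivisionRing (D i)] [∀ i, Algebra k (D i)]
    [∀ i, FiniteDimensional k (D i)]
    {M : Type u} [AddCommGroup M] [Module k M] [FiniteDimensional k M]
    [Module (∀ i, D i) M] [Module (∀ i, D i)ᵐᵒᵖ M] [SMulCommClass (∀ i, D i) (∀ i, D i)ᵐᵒᵖ M]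
    [IsScalarTower k (∀ i, D i) M] [IsScalarTower k (∀ i, D i)ᵐᵒᵖ M]
    (hDynkin : IsDynkinCartan (cartanMatrix k D M)) (σ : SymmetrisingForm k (∀ i, D i))
    (d : IdentityRepresentatives (∀ i, D i) M) : FiniteDimensional k (Preprojective σ d) := by
  obtain ⟨K, hK⟩ := exists_finrank_cyclic_le hDynkin σ d
  refine finiteDimensional_of_cyclic_bound σ d K fun n => ?_
  have hfin := finiteDimensional_quotient_degreeGE σ d n
  -- The quotient is generated by the class of `1`.
  refine hK (Res σ d (Preprojective σ d ⧸ degreeGE σ d n)) (actions σ d _)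
    ((degreeGE σ d n).mkQ 1) (sum_actions_actions σ d _) fun S h1 hS => ?_
  rw [eq_top_iff]
  intro x _
  obtain ⟨p, rfl⟩ := (degreeGE σ d n).mkQ_surjective x
  refine mem_of_generators σ d
    (S.toAddSubgroup.comap (degreeGE σ d n).mkQ.toAddMonoidHom) h1 (fun a x hx => ?_)
    (fun m x hx => ?_) p
  · exact S.smul_mem (op a) hx
  · exact hS _ hx m

end Preprojective

/-! ## The third syzygy and the inverse Nakayama functor -/

namespace BTensor

variable {A X Y : Type u} [Ring A] [AddCommGroup X] [Module Aᵐᵒᵖ X] [AddCommGroup Y] [Module A Y]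

theorem zero_tmul (y : Y) : tmul A (0 : X) y = 0 := map_zero ((tmulHom A (X := X)).flip y)

theorem tmul_sum {α : Type*} (s : Finset α) (x : X) (y : α → Y) :
    tmul A x (∑ i ∈ s, y i) = ∑ i ∈ s, tmul A x (y i) :=
  map_sum (tmulHom A (Y := Y) x) y s

theorem sum_tmul {α : Type*} (s : Finset α) (x : α → X) (y : Y) :
    tmul A (∑ i ∈ s, x i) y = ∑ i ∈ s, tmul A (x i) y :=
  map_sum ((tmulHom A (X := X)).flip y) x s

end BTensor

namespace Preprojective

section Syzygy

variable {k A M : Type u} [Field k] [Ring A] [Algebra k A]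
  [AddCommGroup M] [Module k M] [Module A M] [Module Aᵐᵒᵖ M] [SMulCommClass A Aᵐᵒᵖ M]
  [IsScalarTower k A M] [IsScalarTower k Aᵐᵒᵖ M] [FiniteDimensional k A]
  (σ : SymmetrisingForm k A) (d : IdentityRepresentatives A M)

instance : IsScalarTower k A (Preprojective σ d) :=
  ⟨fun c a p => by rw [smul_eq, smul_eq, map_smul, smul_mul_assoc]⟩

/-- The homomorphism of left `A`-modules `Π → A` corresponding to `θ ∈ DΠ`. -/
noncomputable def dualLift (θ : KDual k (Preprojective σ d)) (p : Preprojective σ d) : A :=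
  σ.rep
    { toFun := fun b => θ (b • p)
      map_add' := fun b c => by rw [add_smul, KDual.map_add']
      map_smul' := fun c b => by rw [smul_assoc, KDual.map_ksmul]; rfl }

theorem apply_mul_dualLift (θ : KDual k (Preprojective σ d)) (p : Preprojective σ d) (b : A) :
    σ.toLinearMap (b * dualLift σ d θ p) = θ (b • p) := σ.apply_mul_rep _ b

theorem dualLift_eq {θ : KDual k (Preprojective σ d)} {p : Preprojective σ d} {a : A}
    (h : ∀ b : A, θ (b • p) = σ.toLinearMap (b * a)) : dualLift σ d θ p = a := σ.rep_eq h

theorem dualLift_add (θ : KDual k (Preprojective σ d)) (p q : Preprojective σ d) :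
    dualLift σ d θ (p + q) = dualLift σ d θ p + dualLift σ d θ q :=
  dualLift_eq σ d fun b => by
    rw [mul_add, map_add, apply_mul_dualLift, apply_mul_dualLift, smul_add, KDual.map_add']

theorem add_dualLift (θ η : KDual k (Preprojective σ d)) (p : Preprojective σ d) :
    dualLift σ d (θ + η) p = dualLift σ d θ p + dualLift σ d η p :=
  dualLift_eq σ d fun b => by
    rw [mul_add, map_add, apply_mul_dualLift, apply_mul_dualLift, KDual.add_apply]

theorem dualLift_smul (θ : KDual k (Preprojective σ d)) (a : A) (p : Preprojective σ d) :
    dualLift σ d θ (a • p) = a * dualLift σ d θ p :=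
  dualLift_eq σ d fun b => by rw [← mul_assoc, apply_mul_dualLift, mul_smul]

theorem dualLift_op_smul_ofRing (θ : KDual k (Preprojective σ d)) (a : A)
    (p : Preprojective σ d) :
    dualLift σ d (op (ofRing σ d a) • θ) p = dualLift σ d θ p * a :=
  dualLift_eq σ d fun b => by
    rw [← mul_assoc, σ.symm, ← mul_assoc, apply_mul_dualLift, KDual.op_smul_apply, mul_smul]
    rfl

theorem dualLift_mul (θ : KDual k (Preprojective σ d)) (p q : Preprojective σ d) :
    dualLift σ d θ (p * q) = dualLift σ d (q • θ) p :=
  dualLift_eq σ d fun b => by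
    rw [apply_mul_dualLift, KDual.smul_apply, op_smul_eq_mul, smul_eq, smul_eq, mul_assoc]

/-- The element of `DΠ` corresponding to a homomorphism of left `A`-modules `Π → A`. -/
def dualOf (h : Preprojective σ d →ₗ[A] A) : KDual k (Preprojective σ d) :=
  σ.toLinearMap.comp (h.restrictScalars k)

theorem dualOf_apply (h : Preprojective σ d →ₗ[A] A) (p : Preprojective σ d) :
    dualOf σ d h p = σ.toLinearMap (h p) := rfl

theorem dualLift_dualOf (h : Preprojective σ d →ₗ[A] A) (p : Preprojective σ d) :
    dualLift σ d (dualOf σ d h) p = h p :=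
  dualLift_eq σ d fun b => by rw [dualOf_apply, map_smul, smul_eq_mul]

/-- Expand `n b = ∑ {n b, u} v` in `θ(n b p)`. Exchanging the arguments of the alternating pairing
moves `n` to the second place and produces the minus sign, which later becomes the sign in `f(θ) n -
f(θ n)`. -/
theorem dualLift_op_smul_ofBimod (θ : KDual k (Preprojective σ d)) (n : M × KDual k M)
    (p : Preprojective σ d) :
    dualLift σ d (op (ofBimod σ d n) • θ) p = -∑ s, (doubleBimoduleForm σ d).form
      ((doubleBimoduleForm σ d).u s)
      (dualLift σ d θ (ofBimod σ d ((doubleBimoduleForm σ d).v s) * p) • n) := by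
  refine dualLift_eq σ d fun b => ?_
  have h : ∀ s, σ.toLinearMap (b * (doubleBimoduleForm σ d).form ((doubleBimoduleForm σ d).u s)
        (dualLift σ d θ (ofBimod σ d ((doubleBimoduleForm σ d).v s) * p) • n))
      = -θ (ofBimod σ d ((doubleBimoduleForm σ d).form (op b • n) ((doubleBimoduleForm σ d).u s)
          • (doubleBimoduleForm σ d).v s) * p) := by
    intro s
    rw [doubleBimoduleForm_form, apply_mul_doubleForm, doublePairing_alt,
      ← doublePairing_op_smul_left, ← smul_comm, ← apply_mul_doubleForm, σ.symm,
      apply_mul_dualLift, ofBimod_smul, smul_eq, mul_assoc]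
    rfl
  rw [mul_neg, Finset.mul_sum, map_neg, map_sum]
  simp only [h, Finset.sum_neg_distrib, neg_neg]
  rw [← KDual.map_sum', ← Finset.sum_mul, ← map_sum, (doubleBimoduleForm σ d).sum_v,
    ofBimod_op_smul, KDual.op_smul_apply, smul_eq, mul_assoc]
  rfl

variable {X : Type u} [AddCommGroup X] [Module (Preprojective σ d)ᵐᵒᵖ X]

/-- The map `X ⊗_A Π → X`, `x ⊗ p ↦ x θ(p)`. -/
noncomputable def evalOuter (θ : KDual k (Preprojective σ d)) : StdOuter σ d X →+ Res σ d X :=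
  BTensor.lift A (AddMonoidHom.mk' (fun x => AddMonoidHom.mk'
      (fun p => op (dualLift σ d θ p) • x)
      (fun p q => by rw [dualLift_add, MulOpposite.op_add, add_smul]))
    (fun x y => AddMonoidHom.ext fun p => smul_add _ _ _))
    (fun x a p => by
      change op (dualLift σ d θ p) • op a • x = op (dualLift σ d θ (a • p)) • x
      rw [dualLift_smul, op_mul, mul_smul])

theorem evalOuter_tmul (θ : KDual k (Preprojective σ d)) (x : Res σ d X)
    (p : Preprojective σ d) :
    evalOuter σ d θ (BTensor.tmul A x p) = op (dualLift σ d θ p) • x := rfl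

theorem evalOuter_add (θ η : KDual k (Preprojective σ d)) (t : StdOuter σ d X) :
    evalOuter σ d (θ + η) t = evalOuter σ d θ t + evalOuter σ d η t := by
  induction t using BTensor.induction_on with
  | h0 => simp
  | h1 x p => simp only [evalOuter_tmul, add_dualLift, MulOpposite.op_add, add_smul]
  | h2 s t hs ht => simp only [map_add, hs, ht]; abel

theorem evalOuter_op_smul_ofRing (θ : KDual k (Preprojective σ d)) (a : A) (t : StdOuter σ d X) :
    evalOuter σ d (op (ofRing σ d a) • θ) t = op a • evalOuter σ d θ t := by
  induction t using BTensor.induction_on with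
  | h0 => simp
  | h1 x p => simp only [evalOuter_tmul, dualLift_op_smul_ofRing, op_mul, mul_smul]
  | h2 s t hs ht => simp only [map_add, hs, ht, smul_add]

theorem evalOuter_op_smul (θ : KDual k (Preprojective σ d)) (q : Preprojective σ d)
    (t : StdOuter σ d X) : evalOuter σ d θ (op q • t) = evalOuter σ d (q • θ) t := by
  induction t using BTensor.induction_on with
  | h0 => simp
  | h1 x p => rw [BTensor.smul_def, evalOuter_tmul, evalOuter_tmul, op_smul_eq_mul, dualLift_mul]
  | h2 s t hs ht => simp only [map_add, smul_add, hs, ht]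

/-- The map `X ⊗_A (M ⊕ DM) → X`, `x ⊗ n ↦ x {n, w}`. -/
noncomputable def contract (w : M × KDual k M) :
    BTensor A (Res σ d X) (M × KDual k M) →+ Res σ d X :=
  BTensor.lift A (AddMonoidHom.mk' (fun x => AddMonoidHom.mk'
      (fun n => op ((doubleBimoduleForm σ d).form n w) • x)
      (fun n n' => by
        rw [map_add, AddMonoidHom.add_apply, MulOpposite.op_add, add_smul]))
    (fun x y => AddMonoidHom.ext fun p => smul_add _ _ _))
    (fun x a n => by
      change op ((doubleBimoduleForm σ d).form n w) • op a • x
        = op ((doubleBimoduleForm σ d).form (a • n) w) • x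
      rw [(doubleBimoduleForm σ d).smul_left, op_mul, mul_smul])

theorem contract_tmul (w : M × KDual k M) (x : Res σ d X) (n : M × KDual k M) :
    contract σ d w (BTensor.tmul A x n) = op ((doubleBimoduleForm σ d).form n w) • x := rfl

theorem contract_add (w w' : M × KDual k M) (t : BTensor A (Res σ d X) (M × KDual k M)) :
    contract σ d (w + w') t = contract σ d w t + contract σ d w' t := by
  induction t using BTensor.induction_on with
  | h0 => simp
  | h1 x n => simp only [contract_tmul, map_add, MulOpposite.op_add, add_smul]
  | h2 s t hs ht => simp only [map_add, hs, ht]; abel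

theorem contract_op_smul (w : M × KDual k M) (a : A)
    (t : BTensor A (Res σ d X) (M × KDual k M)) :
    contract σ d w (op a • t) = contract σ d (a • w) t := by
  induction t using BTensor.induction_on with
  | h0 => simp
  | h1 x n => rw [BTensor.smul_def, contract_tmul, contract_tmul, (doubleBimoduleForm σ d).balanced]
  | h2 s t hs ht => simp only [map_add, smul_add, hs, ht]

theorem sum_tmul_contract (t : BTensor A (Res σ d X) (M × KDual k M)) :
    ∑ s, BTensor.tmul A (contract σ d ((doubleBimoduleForm σ d).u s) t)
      ((doubleBimoduleForm σ d).v s) = t := by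
  induction t using BTensor.induction_on with
  | h0 =>
    simp only [map_zero, BTensor.zero_tmul, Finset.sum_const_zero]
  | h1 x n =>
    simp only [contract_tmul, BTensor.smul_tmul]
    rw [← BTensor.tmul_sum, (doubleBimoduleForm σ d).sum_v n]
  | h2 s t hs ht =>
    simp only [map_add, BTensor.add_tmul, Finset.sum_add_distrib, hs, ht]

/-- The map `X ⊗_A (M ⊕ DM) ⊗_A Π → X`, `x ⊗ n ⊗ p ↦ x {n, θ(p) w}`. -/
noncomputable def evalMiddle (θ : KDual k (Preprojective σ d)) (w : M × KDual k M) :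
    StdMiddle σ d X →+ Res σ d X :=
  BTensor.lift A (AddMonoidHom.mk' (fun t => AddMonoidHom.mk'
      (fun p => contract σ d (dualLift σ d θ p • w) t)
      (fun p q => by rw [dualLift_add, add_smul, contract_add]))
    (fun s t => AddMonoidHom.ext fun p => map_add (contract σ d (dualLift σ d θ p • w)) s t))
    (fun t a p => by
      change contract σ d (dualLift σ d θ p • w) (op a • t)
        = contract σ d (dualLift σ d θ (a • p) • w) t
      rw [contract_op_smul, dualLift_smul, mul_smul])

theorem evalMiddle_tmul (θ : KDual k (Preprojective σ d)) (w : M × KDual k M)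
    (t : BTensor A (Res σ d X) (M × KDual k M)) (p : Preprojective σ d) :
    evalMiddle σ d θ w (BTensor.tmul A t p) = contract σ d (dualLift σ d θ p • w) t := rfl

theorem evalMiddle_tmul₃ (θ : KDual k (Preprojective σ d)) (w : M × KDual k M)
    (x : Res σ d X) (n : M × KDual k M) (p : Preprojective σ d) :
    evalMiddle σ d θ w (tmul₃ σ d x n p)
      = op ((doubleBimoduleForm σ d).form n (dualLift σ d θ p • w)) • x := rfl

theorem leftMapAux_eq_sum (x : Res σ d X) (p : Preprojective σ d) :
    leftMapAux σ d x p = ∑ s, leftTerm σ d x p ((doubleBimoduleForm σ d).u s)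
      ((doubleBimoduleForm σ d).v s) :=
  (sum_doubleBimoduleForm σ d (fun n n' => leftTerm σ d x p n n')
    (fun n n' => DFunLike.congr_fun (map_neg (leftTermHom σ d x p) n) n')).symm

/-- The heart of the second half: the kernel condition is compatibility with the action of `M ⊕ DM`.
On `x ⊗ p`, the terms `x u ⊗ v ⊗ p` sum to `x θ(p) n` by the defining property of the canonical
element. The terms `x ⊗ u ⊗ v p` give the action of `n` on `θ`, by `dualLift_op_smul_ofBimod`. -/
theorem evalMiddle_leftMap (θ : KDual k (Preprojective σ d)) (n : M × KDual k M)
    (t : StdOuter σ d X) :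
    evalMiddle σ d θ n (leftMap σ d X t)
      = act σ d (evalOuter σ d θ t) n - evalOuter σ d (op (ofBimod σ d n) • θ) t := by
  induction t using BTensor.induction_on with
  | h0 => simp [act]
  | h1 x p =>
    rw [leftMap_tmul, leftMapAux_eq_sum, map_sum]
    simp only [leftTerm, map_add, evalMiddle_tmul₃]
    rw [Finset.sum_add_distrib, sub_eq_add_neg]
    congr 1
    · simp only [← act_smul_right]
      rw [evalOuter_tmul, act_smul_left]
      conv_rhs => rw [← (doubleBimoduleForm σ d).sum_u (dualLift σ d θ p • n)]
      exact (map_sum (AddMonoidHom.mk' (act σ d x) (act_add_right σ d x)) _ _).symm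
    · rw [evalOuter_tmul, dualLift_op_smul_ofBimod, MulOpposite.op_neg, neg_smul, neg_neg,
        Finset.op_sum, Finset.sum_smul]
  | h2 s t hs ht =>
    simp only [map_add, hs, ht, act_add_left]
    abel

/-! ### Recovering tensors and functionals from a dual basis of `Π` over `A` -/

section DualBasis

variable {l : ℕ} {y : Fin l → Preprojective σ d} {h : Fin l → (Preprojective σ d →ₗ[A] A)}

theorem sum_tmul_evalOuter (hy : ∀ p, ∑ i, h i p • y i = p) (t : StdOuter σ d X) :
    ∑ i, BTensor.tmul A (evalOuter σ d (dualOf σ d (h i)) t) (y i) = t := by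
  induction t using BTensor.induction_on with
  | h0 =>
    simp only [map_zero, BTensor.zero_tmul, Finset.sum_const_zero]
  | h1 x p =>
    simp only [evalOuter_tmul, BTensor.smul_tmul, dualLift_dualOf]
    rw [← BTensor.tmul_sum, hy]
  | h2 s t hs ht =>
    simp only [map_add, BTensor.add_tmul, Finset.sum_add_distrib, hs, ht]

theorem sum_tmul₃_evalMiddle (hy : ∀ p, ∑ i, h i p • y i = p) (t : StdMiddle σ d X) :
    ∑ i, ∑ s, tmul₃ σ d (evalMiddle σ d (dualOf σ d (h i)) ((doubleBimoduleForm σ d).u s) t)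
      ((doubleBimoduleForm σ d).v s) (y i) = t := by
  induction t using BTensor.induction_on with
  | h0 =>
    simp only [map_zero, tmul₃, BTensor.zero_tmul, Finset.sum_const_zero]
  | h1 t p =>
    have e : ∀ i, ∑ s, tmul₃ σ d (contract σ d (h i p • (doubleBimoduleForm σ d).u s) t)
        ((doubleBimoduleForm σ d).v s) (y i) = BTensor.tmul A t (h i p • y i) := by
      intro i
      rw [← BTensor.smul_tmul]
      conv_rhs => rw [← sum_tmul_contract σ d (op (h i p) • t)]
      simp only [contract_op_smul]
      exact (BTensor.sum_tmul _ _ _).symm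
    simp only [evalMiddle_tmul, dualLift_dualOf, e]
    rw [← BTensor.tmul_sum, hy]
  | h2 s t hs ht =>
    simp only [map_add, tmul₃_add_left, Finset.sum_add_distrib, hs, ht]

/-- Hence the functionals `σ ∘ h i` generate `DΠ` as a right `A`-module, and an `A`-linear map out
of `DΠ` is determined by its values on them. -/
theorem sum_op_smul_dualOf (hy : ∀ p, ∑ i, h i p • y i = p)
    (θ : KDual k (Preprojective σ d)) :
    ∑ i, op (ofRing σ d (dualLift σ d θ (y i))) • dualOf σ d (h i) = θ := by
  refine KDual.ext fun p => ?_
  rw [KDual.sum_apply]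
  conv_rhs => rw [← hy p, KDual.map_sum']
  refine Finset.sum_congr rfl fun i _ => ?_
  rw [KDual.op_smul_apply, dualOf_apply, ← apply_mul_dualLift σ d θ (y i), ← σ.symm]
  exact congrArg _ ((h i).map_smul _ _)

end DualBasis

/-- Compatibility with `A` holds for every tensor, and compatibility with `M ⊕ DM` is the kernel
condition; these generate `Π`. -/
theorem evalOuter_op_smul_of_mem_thirdSyzygy (t : ThirdSyzygy σ d X)
    (q : (Preprojective σ d)ᵐᵒᵖ) (θ : KDual k (Preprojective σ d)) :
    evalOuter σ d (q • θ) t.1 = q • evalOuter σ d θ t.1 := by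
  obtain ⟨q, rfl⟩ := op_surjective q
  -- An additive map is `Π`-linear when its graph is stable under `Π`, and stability of a subgroup
  -- can be checked on generators.
  let S : AddSubgroup (KDual k (Preprojective σ d) × Res σ d X) :=
    (AddMonoidHom.mk' (fun θ => evalOuter σ d θ t.1) (fun θ η => evalOuter_add σ d θ η t.1)).graph
  refine op_smul_mem_of_generators σ d S (fun a x hx => ?_) (fun n x hx => ?_) q
    (θ, evalOuter σ d θ t.1) rfl
  · obtain ⟨η, x⟩ := x
    have hx' : evalOuter σ d η t.1 = x := hx
    subst hx'
    exact evalOuter_op_smul_ofRing σ d η a t.1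
  · obtain ⟨η, x⟩ := x
    have hx' : evalOuter σ d η t.1 = x := hx
    subst hx'
    have h := evalMiddle_leftMap σ d η n t.1
    rw [show leftMap σ d X t.1 = 0 from t.2, map_zero] at h
    exact (sub_eq_zero.1 h.symm).symm

variable (X) in
/-- The homomorphism from the third syzygy of `X` to `Hom_Π(DΠ, X)`. -/
noncomputable def syzygyToNakayama :
    ThirdSyzygy σ d X →ₗ[(Preprojective σ d)ᵐᵒᵖ] NakayamaHom k (Preprojective σ d) X where
  toFun t :=
    { toFun := fun θ => evalOuter σ d θ t.1
      map_add' := fun θ η => evalOuter_add σ d θ η t.1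
      map_smul' := fun q θ => evalOuter_op_smul_of_mem_thirdSyzygy σ d t q θ }
  map_add' s t := NakayamaHom.ext fun θ => map_add (evalOuter σ d θ) s.1 t.1
  map_smul' q t := NakayamaHom.ext fun θ => by
    obtain ⟨q, rfl⟩ := op_surjective q
    exact evalOuter_op_smul σ d θ q t.1

theorem syzygyToNakayama_apply (t : ThirdSyzygy σ d X) (θ : KDual k (Preprojective σ d)) :
    syzygyToNakayama σ d X t θ = evalOuter σ d θ t.1 := rfl

/-- Finite-dimensionality of `Π` is needed for a finite dual basis over `A`: it recovers a tensor
from its evaluations, and it supplies a tensor with prescribed evaluations. -/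
theorem syzygyToNakayama_bijective [IsSemisimpleRing A] [FiniteDimensional k (Preprojective σ d)] :
    Function.Bijective (syzygyToNakayama σ d X) := by
  have : Module.Finite A (Preprojective σ d) :=
    Module.Finite.of_restrictScalars_finite k A (Preprojective σ d)
  obtain ⟨l, y, h, hy⟩ := Module.exists_left_dual_basis A (Preprojective σ d)
  constructor
  · rw [injective_iff_map_eq_zero]
    intro t ht
    refine Subtype.ext ?_
    rw [← sum_tmul_evalOuter σ d hy t.1]
    refine Finset.sum_eq_zero fun i _ => ?_
    rw [← syzygyToNakayama_apply, ht]
    exact BTensor.zero_tmul _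
  · intro f
    let t : StdOuter σ d X := ∑ i, BTensor.tmul A (f (dualOf σ d (h i)) : Res σ d X) (y i)
    have ht : ∀ θ, evalOuter σ d θ t = f θ := by
      intro θ
      rw [map_sum]
      conv_rhs => rw [← sum_op_smul_dualOf σ d hy θ]
      refine Eq.trans ?_ (map_sum f.toLinearMap _ _).symm
      exact Finset.sum_congr rfl fun i _ => (f.toLinearMap.map_smul _ _).symm
    -- An element of the middle term is determined by its evaluations, and those of `leftMap σ d X
    -- t` are `f(θ) n - f(θ n) = 0`.
    have hker : leftMap σ d X t = 0 := by
      rw [← sum_tmul₃_evalMiddle σ d hy (leftMap σ d X t)]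
      refine Finset.sum_eq_zero fun i _ => Finset.sum_eq_zero fun s _ => ?_
      have e : evalMiddle σ d (dualOf σ d (h i)) ((doubleBimoduleForm σ d).u s)
          (leftMap σ d X t) = 0 := by
        rw [evalMiddle_leftMap, ht, ht]
        refine sub_eq_zero.2 ?_
        exact (f.toLinearMap.map_smul _ _).symm
      rw [e, tmul₃, BTensor.zero_tmul, BTensor.zero_tmul]
    exact ⟨⟨t, hker⟩, NakayamaHom.ext ht⟩

theorem evalOuter_outerMap {X' : Type u} [AddCommGroup X'] [Module (Preprojective σ d)ᵐᵒᵖ X']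
    (f : X →ₗ[(Preprojective σ d)ᵐᵒᵖ] X') (θ : KDual k (Preprojective σ d))
    (t : StdOuter σ d X) :
    evalOuter σ d θ (outerMap σ d f t) = resMap σ d f (evalOuter σ d θ t) := by
  induction t using BTensor.induction_on with
  | h0 => simp
  | h1 x p => exact ((resMap σ d f).map_smul _ _).symm
  | h2 s t hs ht => simp only [map_add, hs, ht]

/-- If `Π` is finite-dimensional, then the third syzygy functor is isomorphic to the inverse
Nakayama functor. -/
noncomputable def thirdSyzygyIso [IsSemisimpleRing A] [FiniteDimensional k (Preprojective σ d)] :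
    thirdSyzygyFunctor σ d ≅ inverseNakayamaFunctor k (Preprojective σ d) :=
  NatIso.ofComponents
    (fun X => (LinearEquiv.ofBijective (syzygyToNakayama σ d X)
      (syzygyToNakayama_bijective σ d)).toModuleIso)
    (fun f => ModuleCat.hom_ext (LinearMap.ext fun t => NakayamaHom.ext fun θ =>
      evalOuter_outerMap σ d f.hom θ t.1))

end Syzygy

end Preprojective

theorem mainTheorem8
    (k : Type u) [Field k]
    (ι : Type) [Fintype ι] [DecidableEq ι]
    (D : ι → Type u) [∀ i, DivisionRing (D i)] [∀ i, Algebra k (D i)]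
    [∀ i, FiniteDimensional k (D i)]
    (M : Type u) [AddCommGroup M] [Module k M] [FiniteDimensional k M]
    [Module (∀ i, D i) M] [Module (∀ i, D i)ᵐᵒᵖ M] [SMulCommClass (∀ i, D i) (∀ i, D i)ᵐᵒᵖ M]
    [IsScalarTower k (∀ i, D i) M] [IsScalarTower k (∀ i, D i)ᵐᵒᵖ M]
    (hDynkin : IsDynkinCartan (cartanMatrix k D M))
    (σ : SymmetrisingForm k (∀ i, D i))
    (d : IdentityRepresentatives (∀ i, D i) M) :
    Nonempty (Preprojective.thirdSyzygyFunctor σ d ≅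
      inverseNakayamaFunctor k (Preprojective σ d)) := by
  -- The only use of Dynkin type. Semisimplicity of `A` comes from its being a finite product of
  -- division rings.
  have := Preprojective.finiteDimensional_of_isDynkinCartan hDynkin σ d
  exact ⟨Preprojective.thirdSyzygyIso σ d⟩
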